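/- For $\beta>0$ and $c\ge 0$ let $Q_c(t)=t^2+2c\log\frac1{|t|}$ on $\mathbb R$, let $$E_{\beta,c}(\nu)=\frac{\beta}{2}\int_{\mathbb R^2}\log\frac1{|s-t|}\,\nu(ds)\,\nu(dt)+\int_{\mathbb R}Q_c(t)\,\nu(dt)\in(-\infty,+\infty]$$ for a probability measure $\nu$ on $\mathbb R$ (with $E_{\beta,c}(\nu)=+\infty$ if $\int Q_c\,d\nu=+\infty$), and let $$E^*_{\beta,c}=\inf\{E_{\beta,c}(\nu)\mid \nu \text{ a probability measure on }\mathbb R\}$$ be the energy of the equilibrium measure. Then, for all $\beta>0$ and $c\ge 0$, $$E^*_{\beta,c}=\frac{3\beta}{8}+\frac{\beta}{4}\log\frac4\beta+c\Big(\frac32+\log\frac4\beta\Big)+\frac{2c^2}{\beta}\log\frac{4c}{\beta}-\Big(\frac{2c^2}{\beta}+c+\frac\beta8\Big)\log\Big(1+\frac{4c}{\beta}\Big),$$ where the term $\frac{2c^2}{\beta}\log\frac{4c}{\beta}$ is read as $0$ for $c=0$. -/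

import Mathlib

open MeasureTheory
open scoped ENNReal

noncomputable section

/-- The function `r ↦ log (1 / |r|)` on `ℝ`, with values in `]-∞, +∞]`; its value at `0` is `+∞`. -/
def logInv (r : ℝ) : EReal :=
  if r = 0 then ⊤ else ((Real.log (1 / |r|) : ℝ) : EReal)

/-- The integral of an extended-real function, as the integral of its positive part minus the
integral of its negative part. It is meaningful when at least one of the two is finite. -/
def extIntegral {α : Type*} [MeasurableSpace α] (μ : Measure α) (f : α → EReal) : EReal :=
  ((∫⁻ x, (f x).toENNReal ∂μ : ℝ≥0∞) : EReal) - ((∫⁻ x, (-f x).toENNReal ∂μ : ℝ≥0∞) : EReal)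

/-- The potential `Q_c(t) = t² + 2 c log (1 / |t|)`, with values in `]-∞, +∞]`.
For `c = 0` it is `t²` everywhere, since `0 * ⊤ = 0`. -/
def potentialQ (c : ℝ) (t : ℝ) : EReal :=
  ((t ^ 2 : ℝ) : EReal) + ((2 * c : ℝ) : EReal) * logInv t

open Classical in
/-- The energy of a probability measure `ν` on `ℝ`,
`E_{β,c}(ν) = (β / 2) ∬ log (1 / |s - t|) ν(ds) ν(dt) + ∫ Q_c(t) ν(dt)`, in `]-∞, +∞]`.
For `c ≥ 0` the function `Q_c` is bounded below, so `∫ Q_c dν` always makes sense. If it is finite,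
then `ν` has a finite second moment and the double integral makes sense in `]-∞, +∞]`. If it is
infinite, the energy is `+∞`: this is the value of the double integral of
`(β / 2) log (1 / |s - t|) + Q_c(s) / 2 + Q_c(t) / 2`, a function which is bounded below. -/
def logEnergy (β c : ℝ) (ν : ProbabilityMeasure ℝ) : EReal :=
  if extIntegral (ν : Measure ℝ) (potentialQ c) = ⊤ then ⊤
  else ((β / 2 : ℝ) : EReal) *
      extIntegral ((ν : Measure ℝ).prod (ν : Measure ℝ)) (fun p => logInv (p.1 - p.2)) +
    extIntegral (ν : Measure ℝ) (potentialQ c)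

/-- The equilibrium energy `E*_{β,c}`: the infimum of the energy over all probability measures
on `ℝ`. -/
def equilibriumEnergy (β c : ℝ) : EReal :=
  ⨅ ν : ProbabilityMeasure ℝ, logEnergy β c ν

end

/-! Write `U(x)` for the integral of `log |x - s|` against the measure `eqMeasure β c`, and `Q` for
the potential. The Euler–Lagrange conditions hold: `β U ≤ Q - R`, with equality on the support,
where `R = robinConstant β c` (`mul_potential_le`). Integrating the equality shows that the energy
of this measure is `(∫ Q + R) / 2`. For another measure of finite energy, the inequality bounds the
mixed energy, and the conditional negative definiteness of `log |s - t|`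
(`integral_log_abs_sub_prod_self_add_le`) turns this into a lower bound for its own energy
(`energy_lower_bound`).

The density of the equilibrium measure is never used. In the variable `u = t²`, the support of the
equilibrium measure of mass `τ` is the interval `(u - c)² ≤ β τ u`, and the measure of mass one is
the mixture over `τ ∈ (0, 1]` of the arcsine laws of these growing intervals. The potential of an
arcsine law is explicit by Jensen's formula, constant on its interval and larger outside. The
Euler–Lagrange conditions reduce to one integral over `τ`: the excess at `u` vanishes once `τ ≥ T =
(u - c)² / (β u)`, and its integral up to `T` is `2 / β` times `u - c - c log (u / c)`
(`integral_excess_of_eq`). Stopping at `1` loses nothing if `T ≤ 1`, and loses a nonnegative amount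
otherwise.

Negative definiteness comes from writing the regularised kernel `log (r² + δ²) / 2` as an integral
of `1 - cos (r ξ)` against a positive weight, then letting `δ` tend to `0`. -/

open Set Filter Topology

/-! ### Conditional negative definiteness of the regularised logarithm -/

lemma integral_exp_neg_mul_sin {δ : ℝ} (hδ : 0 < δ) (r : ℝ) :
    ∫ ξ in Ioi (0 : ℝ), Real.exp (-δ * ξ) * Real.sin (r * ξ) = r / (δ ^ 2 + r ^ 2) := by
  have ha : ((-δ : ℂ) + r * Complex.I).re < 0 := by simpa using hδ
  have h := integral_exp_mul_complex_Ioi ha 0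
  have hi := integrableOn_exp_mul_complex_Ioi ha 0
  have h2 := congrArg Complex.im h
  rw [← RCLike.im_eq_complex_im, ← integral_im hi] at h2
  have hne : δ ^ 2 + r ^ 2 ≠ 0 := by positivity
  have e1 : ∀ ξ : ℝ, RCLike.im (Complex.exp (((-δ : ℂ) + r * Complex.I) * ξ))
      = Real.exp (-δ * ξ) * Real.sin (r * ξ) := by
    intro ξ
    rw [RCLike.im_eq_complex_im, Complex.exp_im]
    simp
  simp only [e1] at h2
  rw [h2]
  simp [Complex.div_im, Complex.normSq_apply]
  field_simp

lemma integrableOn_exp_neg_mul {δ : ℝ} (hδ : 0 < δ) :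
    IntegrableOn (fun ξ : ℝ => Real.exp (-δ * ξ)) (Ioi 0) :=
  integrableOn_exp_mul_Ioi (by linarith) 0

lemma abs_one_sub_cos_div_le {r ξ : ℝ} (hξ : 0 < ξ) : |(1 - Real.cos (r * ξ)) / ξ| ≤ |r| := by
  rw [abs_div, abs_of_pos hξ, div_le_iff₀ hξ]
  have h := Real.abs_cos_sub_cos_le 0 (r * ξ)
  simpa [abs_mul, abs_of_pos hξ] using h

lemma integrableOn_exp_mul_one_sub_cos {δ : ℝ} (hδ : 0 < δ) (r : ℝ) :
    IntegrableOn (fun ξ : ℝ => Real.exp (-δ * ξ) * ((1 - Real.cos (r * ξ)) / ξ)) (Ioi 0) := by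
  refine Integrable.mono' ((integrableOn_exp_neg_mul hδ).mul_const |r|)
    (by fun_prop) ?_
  filter_upwards [ae_restrict_mem measurableSet_Ioi] with ξ hξ
  rw [norm_mul, Real.norm_eq_abs, Real.norm_eq_abs, Real.abs_exp]
  exact mul_le_mul_of_nonneg_left (abs_one_sub_cos_div_le hξ) (Real.exp_pos _).le

/-- Both sides vanish at `r = 0` and have derivative `r / (δ² + r²)`. The factor `exp (-δ ξ)` makes
the integral converge at infinity and dominates the differentiated integrand. -/
lemma half_log_one_add_div_eq_integral {δ : ℝ} (hδ : 0 < δ) (r : ℝ) :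
    ∫ ξ in Ioi (0 : ℝ), Real.exp (-δ * ξ) * ((1 - Real.cos (r * ξ)) / ξ)
      = Real.log (r ^ 2 + δ ^ 2) / 2 - Real.log δ := by
  set G : ℝ → ℝ := fun r => ∫ ξ in Ioi (0 : ℝ), Real.exp (-δ * ξ) * ((1 - Real.cos (r * ξ)) / ξ)
  have hG : ∀ x, HasDerivAt G (x / (δ ^ 2 + x ^ 2)) x := by
    intro x
    have := (hasDerivAt_integral_of_dominated_loc_of_deriv_le (μ := volume.restrict (Ioi (0 : ℝ)))
      (F := fun r ξ => Real.exp (-δ * ξ) * ((1 - Real.cos (r * ξ)) / ξ))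
      (F' := fun r ξ => Real.exp (-δ * ξ) * Real.sin (r * ξ)) (x₀ := x) (s := univ)
      (bound := fun ξ => Real.exp (-δ * ξ)) univ_mem
      (Eventually.of_forall fun r => (integrableOn_exp_mul_one_sub_cos hδ r).aestronglyMeasurable)
      (integrableOn_exp_mul_one_sub_cos hδ x) (by fun_prop)
      (Eventually.of_forall fun ξ r _ => ?_) (integrableOn_exp_neg_mul hδ) ?_).2
    · rwa [integral_exp_neg_mul_sin hδ] at this
    · rw [norm_mul, Real.norm_eq_abs, Real.norm_eq_abs, Real.abs_exp]
      exact mul_le_of_le_one_right (Real.exp_pos _).le (Real.abs_sin_le_one _)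
    · filter_upwards [ae_restrict_mem measurableSet_Ioi] with ξ hξ r _
      have hξ0 : ξ ≠ 0 := (ne_of_gt hξ)
      have h1 : HasDerivAt (fun r => r * ξ) ξ r := by simpa using (hasDerivAt_id r).mul_const ξ
      have := (((h1.cos).const_sub 1).div_const ξ).const_mul (Real.exp (-δ * ξ))
      refine this.congr_deriv ?_
      field_simp
  have hL : ∀ x, HasDerivAt (fun x => Real.log (x ^ 2 + δ ^ 2) / 2 - Real.log δ)
      (x / (δ ^ 2 + x ^ 2)) x := by
    intro x
    have hp : x ^ 2 + δ ^ 2 ≠ 0 := by positivity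
    have := ((((hasDerivAt_pow 2 x).add_const (δ ^ 2)).log hp).div_const 2).sub_const (Real.log δ)
    refine this.congr_deriv ?_
    simp only [Nat.cast_ofNat, Nat.add_one_sub_one, pow_one]
    rw [div_div, add_comm (x ^ 2), mul_comm _ (2 : ℝ), mul_div_mul_left _ _ two_ne_zero]
  have hd : ∀ x, HasDerivAt (fun x => G x - (Real.log (x ^ 2 + δ ^ 2) / 2 - Real.log δ)) 0 x := by
    intro x
    exact ((hG x).sub (hL x)).congr_deriv (sub_self _)
  have hc := is_const_of_deriv_eq_zero (fun x => (hd x).differentiableAt)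
    (fun x => (hd x).deriv) r 0
  have h0 : G 0 = 0 := by simp [G]
  have hl : Real.log (0 ^ 2 + δ ^ 2) / 2 - Real.log δ = 0 := by
    simp
  rw [hl, h0] at hc
  linarith

section Positivity

variable (ν μ : Measure ℝ) [IsProbabilityMeasure ν] [IsProbabilityMeasure μ]

lemma integrable_sub_prod (hν : Integrable (fun x => x) ν) (hμ : Integrable (fun x => x) μ) :
    Integrable (fun p : ℝ × ℝ => p.1 - p.2) (ν.prod μ) :=
  (hν.comp_fst μ).sub (hμ.comp_snd ν)

/-- The addition formula separates the variables; this is the real part of a product of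
characteristic functions. -/
lemma integral_cos_sub_prod (ξ : ℝ) :
    ∫ p : ℝ × ℝ, Real.cos ((p.1 - p.2) * ξ) ∂(ν.prod μ)
      = (∫ x, Real.cos (x * ξ) ∂ν) * (∫ x, Real.cos (x * ξ) ∂μ)
        + (∫ x, Real.sin (x * ξ) ∂ν) * (∫ x, Real.sin (x * ξ) ∂μ) := by
  have hc : ∀ ρ : Measure ℝ, [IsProbabilityMeasure ρ] → Integrable (fun x => Real.cos (x * ξ)) ρ :=
    fun ρ _ => Integrable.of_bound (by fun_prop) 1 (Eventually.of_forall fun x => Real.abs_cos_le_one _)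
  have hs : ∀ ρ : Measure ℝ, [IsProbabilityMeasure ρ] → Integrable (fun x => Real.sin (x * ξ)) ρ :=
    fun ρ _ => Integrable.of_bound (by fun_prop) 1 (Eventually.of_forall fun x => Real.abs_sin_le_one _)
  rw [← integral_prod_mul, ← integral_prod_mul, ← integral_add ((hc ν).mul_prod (hc μ))
    ((hs ν).mul_prod (hs μ))]
  refine integral_congr_ae (Eventually.of_forall fun p => ?_)
  simp only [sub_mul, Real.cos_sub]

lemma integrable_exp_mul_one_sub_cos_prod {δ : ℝ} (hδ : 0 < δ)
    (hν : Integrable (fun x => x) ν) (hμ : Integrable (fun x => x) μ) :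
    Integrable (fun q : ℝ × (ℝ × ℝ) =>
      Real.exp (-δ * q.1) * ((1 - Real.cos ((q.2.1 - q.2.2) * q.1)) / q.1))
      ((volume.restrict (Ioi 0)).prod (ν.prod μ)) := by
  refine Integrable.mono'
    ((integrableOn_exp_neg_mul hδ).mul_prod (integrable_sub_prod ν μ hν hμ).norm)
    (Measurable.aestronglyMeasurable (by fun_prop)) ?_
  have : ∀ᵐ q : ℝ × (ℝ × ℝ) ∂((volume.restrict (Ioi 0)).prod (ν.prod μ)), 0 < q.1 :=
    Measure.quasiMeasurePreserving_fst.ae (ae_restrict_mem measurableSet_Ioi)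
  filter_upwards [this] with q hq
  rw [norm_mul, Real.norm_eq_abs, Real.norm_eq_abs, Real.abs_exp]
  exact mul_le_mul_of_nonneg_left (abs_one_sub_cos_div_le hq) (Real.exp_pos _).le

lemma integrable_log_sq_add_prod {δ : ℝ} (hδ : 0 < δ)
    (hν : Integrable (fun x => x) ν) (hμ : Integrable (fun x => x) μ) :
    Integrable (fun p : ℝ × ℝ => Real.log ((p.1 - p.2) ^ 2 + δ ^ 2) / 2) (ν.prod μ) := by
  have h := (integrable_exp_mul_one_sub_cos_prod ν μ hδ hν hμ).integral_prod_right
  simp only [half_log_one_add_div_eq_integral hδ] at h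
  exact (h.add (integrable_const (Real.log δ))).congr
    (Eventually.of_forall fun p => sub_add_cancel _ _)

lemma integral_log_sq_add_prod {δ : ℝ} (hδ : 0 < δ)
    (hν : Integrable (fun x => x) ν) (hμ : Integrable (fun x => x) μ) :
    ∫ p : ℝ × ℝ, Real.log ((p.1 - p.2) ^ 2 + δ ^ 2) / 2 ∂(ν.prod μ) - Real.log δ
      = ∫ ξ in Ioi (0 : ℝ), Real.exp (-δ * ξ) * ((1 -
        ((∫ x, Real.cos (x * ξ) ∂ν) * (∫ x, Real.cos (x * ξ) ∂μ)
        + (∫ x, Real.sin (x * ξ) ∂ν) * (∫ x, Real.sin (x * ξ) ∂μ))) / ξ) := by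
  have h := integral_integral_swap (f := fun ξ (p : ℝ × ℝ) =>
    Real.exp (-δ * ξ) * ((1 - Real.cos ((p.1 - p.2) * ξ)) / ξ)) (integrable_exp_mul_one_sub_cos_prod ν μ hδ hν hμ)
  simp only [half_log_one_add_div_eq_integral hδ] at h
  rw [integral_sub (integrable_log_sq_add_prod ν μ hδ hν hμ) (integrable_const _)] at h
  simp only [integral_const, probReal_univ, one_smul] at h
  rw [← h]
  refine integral_congr_ae (Eventually.of_forall fun ξ => ?_)
  simp only
  rw [integral_const_mul, integral_div, integral_sub (integrable_const _), integral_cos_sub_prod]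
  · simp
  · exact Integrable.of_bound (by fun_prop) 1 (Eventually.of_forall fun x => Real.abs_cos_le_one _)

lemma integrableOn_charFun_integrand {δ : ℝ} (hδ : 0 < δ)
    (hν : Integrable (fun x => x) ν) (hμ : Integrable (fun x => x) μ) :
    IntegrableOn (fun ξ : ℝ => Real.exp (-δ * ξ) * ((1 -
        ((∫ x, Real.cos (x * ξ) ∂ν) * (∫ x, Real.cos (x * ξ) ∂μ)
        + (∫ x, Real.sin (x * ξ) ∂ν) * (∫ x, Real.sin (x * ξ) ∂μ))) / ξ)) (Ioi 0) := by
  refine (integrable_exp_mul_one_sub_cos_prod ν μ hδ hν hμ).integral_prod_left.congr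
    (Eventually.of_forall fun ξ => ?_)
  simp only
  rw [integral_const_mul, integral_div, integral_sub (integrable_const _), integral_cos_sub_prod]
  · simp
  · exact Integrable.of_bound (by fun_prop) 1 (Eventually.of_forall fun x => Real.abs_cos_le_one _)

/-- The kernel `log (r² + δ²) / 2` is conditionally negative definite. -/
theorem integral_log_sq_add_prod_self_add_le {δ : ℝ} (hδ : 0 < δ)
    (hν : Integrable (fun x => x) ν) (hμ : Integrable (fun x => x) μ) :
    ∫ p : ℝ × ℝ, Real.log ((p.1 - p.2) ^ 2 + δ ^ 2) / 2 ∂(ν.prod ν)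
      + ∫ p : ℝ × ℝ, Real.log ((p.1 - p.2) ^ 2 + δ ^ 2) / 2 ∂(μ.prod μ)
      ≤ 2 * ∫ p : ℝ × ℝ, Real.log ((p.1 - p.2) ^ 2 + δ ^ 2) / 2 ∂(ν.prod μ) := by
  have h1 := integral_log_sq_add_prod ν ν hδ hν hν
  have h2 := integral_log_sq_add_prod μ μ hδ hμ hμ
  have h3 := integral_log_sq_add_prod ν μ hδ hν hμ
  have i1 := integrableOn_charFun_integrand ν ν hδ hν hν
  have i2 := integrableOn_charFun_integrand μ μ hδ hμ hμ
  have i3 := integrableOn_charFun_integrand ν μ hδ hν hμ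
  suffices h : (∫ p : ℝ × ℝ, Real.log ((p.1 - p.2) ^ 2 + δ ^ 2) / 2 ∂(ν.prod ν) - Real.log δ)
      + (∫ p : ℝ × ℝ, Real.log ((p.1 - p.2) ^ 2 + δ ^ 2) / 2 ∂(μ.prod μ) - Real.log δ)
      ≤ 2 * (∫ p : ℝ × ℝ, Real.log ((p.1 - p.2) ^ 2 + δ ^ 2) / 2 ∂(ν.prod μ) - Real.log δ) by
    linarith
  rw [h1, h2, h3, ← integral_const_mul, ← integral_add i1 i2]
  refine setIntegral_mono_on (i1.add i2) (i3.const_mul 2) measurableSet_Ioi fun ξ hξ => ?_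
  have hξ' : 0 < ξ := hξ
  have he := Real.exp_pos (-δ * ξ)
  rw [← mul_add, mul_left_comm, ← add_div]
  refine mul_le_mul_of_nonneg_left ?_ he.le
  rw [← mul_div_assoc]
  gcongr
  -- The two squares add up to the squared modulus of the difference of the characteristic
  -- functions.
  nlinarith [sq_nonneg (∫ x, Real.cos (x * ξ) ∂ν - ∫ x, Real.cos (x * ξ) ∂μ),
    sq_nonneg (∫ x, Real.sin (x * ξ) ∂ν - ∫ x, Real.sin (x * ξ) ∂μ)]

end Positivity

/-! ### The logarithmic potential of an arcsine law -/

/-- On the unit circle `2 cos θ = z + 1 / z`, so `-z (b - d cos θ)` is a quadratic polynomial in `z`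
with roots `z₁`, `z₂`. The logarithm then splits into two terms to which Jensen's formula applies.
-/
lemma abs_sub_mul_cos_eq {b d : ℝ} {z₁ z₂ : ℂ} (hsum : d * (z₁ + z₂) = 2 * b)
    (hprod : z₁ * z₂ = 1) (θ : ℝ) :
    |b - d * Real.cos θ| = ‖((d / 2 : ℝ) : ℂ) * ((circleMap 0 1 θ - z₁) * (circleMap 0 1 θ - z₂))‖ := by
  have hz : ‖circleMap 0 1 θ‖ = 1 := by simp
  set z := circleMap 0 1 θ with hzdef
  have hcos : z ^ 2 + 1 = 2 * Real.cos θ * z := by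
    rw [hzdef, circleMap_zero, Complex.ofReal_one, one_mul, Complex.ofReal_cos,
      Complex.cos, mul_div_cancel₀ _ (two_ne_zero), add_mul, sq, ← Complex.exp_add,
      ← Complex.exp_add]
    simp
  have : ((d / 2 : ℝ) : ℂ) * ((z - z₁) * (z - z₂)) = -(((b - d * Real.cos θ : ℝ) : ℂ) * z) := by
    push_cast at hcos ⊢
    linear_combination (d / 2 : ℂ) * hcos + (d / 2 : ℂ) * hprod - z / 2 * hsum
  rw [this, norm_neg, norm_mul, hz, mul_one, Complex.norm_real, Real.norm_eq_abs]

lemma ae_circleMap_ne (w : ℂ) : ∀ᵐ θ : ℝ, circleMap 0 1 θ ≠ w := by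
  have := (countable_singleton w).preimage_circleMap 0 one_ne_zero
  exact this.ae_notMem volume

/-- If `|b| ≥ d`, the roots are real and inverse to each other, and only the larger contributes to
`posLog`. If `|b| ≤ d`, they are conjugate on the unit circle and neither contributes. The maximum
merges the two cases. -/
lemma exists_roots (b : ℝ) {d : ℝ} (hd : 0 < d) : ∃ z₁ z₂ : ℂ, d * (z₁ + z₂) = 2 * b ∧ z₁ * z₂ = 1 ∧
    Real.log (d / 2) + (Real.posLog ‖z₁‖ + Real.posLog ‖z₂‖)
      = Real.log ((max |b| d + √((max |b| d) ^ 2 - d ^ 2)) / 2) := by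
  have hdc : (d : ℂ) ≠ 0 := by exact_mod_cast hd.ne'
  rcases le_total d |b| with h | h
  · rw [max_eq_left h]
    set s := √(|b| ^ 2 - d ^ 2) with hs
    have hs0 : 0 ≤ s := Real.sqrt_nonneg _
    have hs2 : s ^ 2 = |b| ^ 2 - d ^ 2 := Real.sq_sqrt (by nlinarith)
    obtain ⟨e, he, hb⟩ : ∃ e : ℝ, |e| = 1 ∧ b = e * |b| := by
      rcases le_total 0 b with hb | hb
      · exact ⟨1, by simp, by simp [abs_of_nonneg hb]⟩
      · exact ⟨-1, by simp, by simp [abs_of_nonpos hb]⟩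
    have he2 : e * e = 1 := by rw [← abs_mul_abs_self, he, one_mul]
    have hb0 : 0 < |b| := hd.trans_le h
    have hsb : s ≤ |b| := by nlinarith
    refine ⟨((e * ((|b| + s) / d) : ℝ) : ℂ), ((e * ((|b| - s) / d) : ℝ) : ℂ), ?_, ?_, ?_⟩
    · norm_cast
      conv_rhs => rw [hb]
      field_simp
      ring
    · norm_cast
      field_simp
      nlinarith
    · rw [Complex.norm_real, Complex.norm_real, norm_mul, norm_mul, Real.norm_eq_abs e, he, one_mul,
        one_mul, Real.norm_of_nonneg (by positivity),
        Real.norm_of_nonneg (div_nonneg (by linarith) hd.le),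
        Real.posLog_eq_log (by rw [abs_of_nonneg (by positivity), le_div_iff₀ hd]; linarith),
        (Real.posLog_eq_zero_iff _).2, add_zero, ← Real.log_mul (by positivity) (by positivity)]
      · congr 1
        field_simp
      · rw [abs_of_nonneg (div_nonneg (by linarith) hd.le), div_le_one hd]
        nlinarith
  · rw [max_eq_right h]
    have hs2 : √(d ^ 2 - b ^ 2) ^ 2 = d ^ 2 - b ^ 2 :=
      Real.sq_sqrt (by nlinarith [abs_nonneg b, sq_abs b])
    set s := √(d ^ 2 - b ^ 2)
    have hs2' : (s : ℂ) ^ 2 = d ^ 2 - b ^ 2 := by exact_mod_cast hs2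
    have hn : ∀ t : ℝ, t ^ 2 = s ^ 2 → ‖((b : ℂ) + t * Complex.I) / d‖ = 1 := by
      intro t ht
      rw [norm_div, Complex.norm_add_mul_I, ht, hs2, Complex.norm_real, Real.norm_of_nonneg hd.le]
      rw [add_sub_cancel, Real.sqrt_sq hd.le, div_self hd.ne']
    refine ⟨((b : ℂ) + s * Complex.I) / d, ((b : ℂ) + (-s : ℝ) * Complex.I) / d, ?_, ?_, ?_⟩
    · push_cast
      field_simp
      ring
    · push_cast
      field_simp
      linear_combination hs2' - (s : ℂ) ^ 2 * Complex.I_sq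
    · rw [hn s rfl, hn (-s) (neg_sq s)]
      simp

/-- The potential at `b` of the arcsine law on `[-d, d]`. -/
theorem intervalIntegral_log_abs_sub_mul_cos (b : ℝ) {d : ℝ} (hd : 0 < d) :
    IntervalIntegrable (fun θ => Real.log |b - d * Real.cos θ|) volume 0 (2 * Real.pi) ∧
    (2 * Real.pi)⁻¹ * ∫ θ in 0..2 * Real.pi, Real.log |b - d * Real.cos θ|
      = Real.log ((max |b| d + √((max |b| d) ^ 2 - d ^ 2)) / 2) := by
  obtain ⟨z₁, z₂, hsum, hprod, hval⟩ := exists_roots b hd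
  have i1 : CircleIntegrable (fun z => Real.log ‖z - z₁‖) 0 1 :=
    circleIntegrable_log_norm_sub_const (a := z₁) (c := 0) 1
  have i2 : CircleIntegrable (fun z => Real.log ‖z - z₂‖) 0 1 :=
    circleIntegrable_log_norm_sub_const (a := z₂) (c := 0) 1
  have h1 := circleAverage_log_norm_sub_const_eq_posLog (a := z₁)
  have h2 := circleAverage_log_norm_sub_const_eq_posLog (a := z₂)
  simp only [Real.circleAverage_def, smul_eq_mul] at h1 h2
  have hae : ∀ᵐ θ : ℝ, Real.log |b - d * Real.cos θ| = Real.log (d / 2) +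
      (Real.log ‖circleMap 0 1 θ - z₁‖ + Real.log ‖circleMap 0 1 θ - z₂‖) := by
    filter_upwards [ae_circleMap_ne z₁, ae_circleMap_ne z₂] with θ e1 e2
    rw [abs_sub_mul_cos_eq hsum hprod, norm_mul, norm_mul, Complex.norm_real,
      Real.norm_of_nonneg (by positivity), Real.log_mul (by positivity), Real.log_mul]
    · exact norm_ne_zero_iff.2 (sub_ne_zero.2 e1)
    · exact norm_ne_zero_iff.2 (sub_ne_zero.2 e2)
    · exact mul_ne_zero (norm_ne_zero_iff.2 (sub_ne_zero.2 e1))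
        (norm_ne_zero_iff.2 (sub_ne_zero.2 e2))
  have i1' : IntervalIntegrable (fun θ => Real.log ‖circleMap 0 1 θ - z₁‖) volume 0 (2 * Real.pi) := i1
  have i2' : IntervalIntegrable (fun θ => Real.log ‖circleMap 0 1 θ - z₂‖) volume 0 (2 * Real.pi) := i2
  have ii := (intervalIntegrable_const (c := Real.log (d / 2))).add (i1'.add i2')
  refine ⟨ii.congr_ae (ae_restrict_of_ae (hae.mono fun θ h => h.symm)), ?_⟩
  rw [intervalIntegral.integral_congr_ae (hae.mono fun θ h _ => h),
    intervalIntegral.integral_add intervalIntegrable_const (i1'.add i2'),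
    intervalIntegral.integral_add i1' i2', mul_add, mul_add, h1, h2, ← hval]
  have := Real.pi_pos
  simp
  field_simp

/-! ### The Euler–Lagrange inequality -/

/-- Midpoint of the support of the equilibrium measure of mass `τ`, in the variable `u = t²`. -/
noncomputable def mid (β c τ : ℝ) : ℝ := c + β * τ / 2

/-- Half-length of the support of the equilibrium measure of mass `τ`, in the variable `u = t²`. -/
noncomputable def rad (β c τ : ℝ) : ℝ := √(β * τ * (β * τ + 4 * c)) / 2

/-- The difference between minus the potential at `u` of the arcsine law on
`[mid - rad, mid + rad]`, and its value inside the support. -/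
noncomputable def excess (β c u τ : ℝ) : ℝ :=
  Real.log ((max |u - mid β c τ| (rad β c τ)
    + √((max |u - mid β c τ| (rad β c τ)) ^ 2 - (rad β c τ) ^ 2)) / 2) - Real.log (rad β c τ / 2)

section

variable {β c : ℝ}

lemma rad_nonneg (β c τ : ℝ) : 0 ≤ rad β c τ := by unfold rad; positivity

lemma rad_pos (hβ : 0 < β) (hc : 0 ≤ c) {τ : ℝ} (hτ : 0 < τ) : 0 < rad β c τ := by
  unfold rad; positivity

lemma rad_sq (hβ : 0 < β) (hc : 0 ≤ c) {τ : ℝ} (hτ : 0 ≤ τ) :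
    rad β c τ ^ 2 = β * τ * (β * τ + 4 * c) / 4 := by
  unfold rad
  rw [div_pow, Real.sq_sqrt (by positivity)]
  norm_num

lemma rad_le_mid (hβ : 0 < β) (hc : 0 ≤ c) {τ : ℝ} (hτ : 0 ≤ τ) : rad β c τ ≤ mid β c τ := by
  refine abs_le_of_sq_le_sq' ?_ (by unfold mid; positivity) |>.2
  rw [rad_sq hβ hc hτ, mid]
  nlinarith [sq_nonneg c]

lemma log_rad_half (hβ : 0 < β) (hc : 0 ≤ c) {τ : ℝ} (hτ : 0 < τ) :
    Real.log (rad β c τ / 2)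
      = Real.log (β * τ) / 2 + Real.log (β * τ + 4 * c) / 2 - Real.log 4 := by
  unfold rad
  rw [div_div, Real.log_div (by positivity) (by norm_num), Real.log_sqrt (by positivity),
    Real.log_mul (by positivity) (by positivity)]
  norm_num
  ring

/-- This identity explains the choice of `mid` and `rad`: membership of `u` in the interval is a
condition linear in `τ`, so for `u > 0` the point enters at one value of `τ` and stays. -/
lemma sq_sub_mid_sub_rad_sq (hβ : 0 < β) (hc : 0 ≤ c) (u : ℝ) {τ : ℝ} (hτ : 0 ≤ τ) :
    (u - mid β c τ) ^ 2 - rad β c τ ^ 2 = (u - c) ^ 2 - β * τ * u := by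
  rw [rad_sq hβ hc hτ, mid]
  ring

lemma excess_nonneg (hβ : 0 < β) (hc : 0 ≤ c) (u : ℝ) {τ : ℝ} (hτ : 0 < τ) :
    0 ≤ excess β c u τ := by
  have hd := rad_pos hβ hc hτ
  unfold excess
  rw [sub_nonneg]
  apply Real.log_le_log (by positivity)
  have := le_max_right |u - mid β c τ| (rad β c τ)
  have := Real.sqrt_nonneg ((max |u - mid β c τ| (rad β c τ)) ^ 2 - (rad β c τ) ^ 2)
  linarith

lemma excess_eq_zero (hβ : 0 < β) (hc : 0 ≤ c) {u τ : ℝ} (hτ : 0 ≤ τ)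
    (h : (u - c) ^ 2 ≤ β * τ * u) : excess β c u τ = 0 := by
  have h1 := sq_sub_mid_sub_rad_sq hβ hc u hτ
  have h2 : |u - mid β c τ| ≤ rad β c τ := abs_le_of_sq_le_sq (by linarith) (rad_nonneg _ _ _)
  unfold excess
  rw [max_eq_right h2]
  simp

lemma excess_eq (hβ : 0 < β) (hc : 0 ≤ c) {u τ : ℝ} (hτ : 0 ≤ τ)
    (h : β * τ * u ≤ (u - c) ^ 2) : excess β c u τ =
    Real.log ((|u - mid β c τ| + √((u - c) ^ 2 - β * τ * u)) / 2) - Real.log (rad β c τ / 2) := by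
  have h1 := sq_sub_mid_sub_rad_sq hβ hc u hτ
  have h2 : rad β c τ ≤ |u - mid β c τ| := Real.abs_le_sqrt (x := rad β c τ)
    (y := |u - mid β c τ| ^ 2) (by rw [sq_abs]; linarith) |> (le_trans (le_abs_self _)) |>.trans_eq
      (Real.sqrt_sq (abs_nonneg _))
  unfold excess
  rw [max_eq_left h2, sq_abs, h1]

/-- A primitive of `τ ↦ excess β c u τ` on the interval where it is positive; `e` is the sign
of `u - c`. -/
noncomputable def excessPrimitive (β c u e τ : ℝ) : ℝ :=
  τ * Real.log ((e * (u - mid β c τ) + √((u - c) ^ 2 - β * τ * u)) / 2)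
  - τ * (Real.log (β * τ) / 2 + Real.log (β * τ + 4 * c) / 2 - Real.log 4)
  + e * (-(2 / β) * √((u - c) ^ 2 - β * τ * u)
      + 2 / β * (c * (Real.log (u + c + √((u - c) ^ 2 - β * τ * u))
        - Real.log (u + c - √((u - c) ^ 2 - β * τ * u)))))

/-- Integration by parts: the first two terms of the primitive form `τ` times the excess, and the
derivative of the last cancels `τ` times the derivative of the excess, which is algebraic in `τ` and
`s`. -/
lemma hasDerivAt_excessPrimitive (hβ : 0 < β) (hc : 0 ≤ c) {u e τ : ℝ} (hu : 0 < u) (he : e * e = 1)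
    (hτ : 0 < τ) (hD : β * τ * u < (u - c) ^ 2) (hm : 0 < e * (u - mid β c τ)) :
    HasDerivAt (excessPrimitive β c u e)
      (Real.log ((e * (u - mid β c τ) + √((u - c) ^ 2 - β * τ * u)) / 2)
        - Real.log (rad β c τ / 2)) τ := by
  set s := √((u - c) ^ 2 - β * τ * u) with hs
  have hs0 : 0 < s := Real.sqrt_pos.2 (by linarith)
  have hs2 : s ^ 2 = (u - c) ^ 2 - β * τ * u := Real.sq_sqrt (by linarith)
  have hβτ : 0 < β * τ := by positivity
  have hprod : (u + c + s) * (u + c - s) = u * (β * τ + 4 * c) := by linear_combination -hs2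
  have hp1 : 0 < u + c + s := by positivity
  have hp2 : 0 < u + c - s := pos_of_mul_pos_right (hprod ▸ (by positivity)) hp1.le
  have hmid : HasDerivAt (fun τ => e * (u - mid β c τ)) (-(e * (β / 2))) τ := by
    have h : HasDerivAt (fun τ => mid β c τ) (β / 2) τ := by
      unfold mid
      simpa using (((hasDerivAt_id τ).const_mul β).div_const 2).const_add c
    exact ((h.const_sub u).const_mul e).congr_deriv (by ring)
  have hsq : HasDerivAt (fun τ => √((u - c) ^ 2 - β * τ * u)) (-(β * u) / (2 * s)) τ := by
    have h : HasDerivAt (fun τ => (u - c) ^ 2 - β * τ * u) (-(β * u)) τ := by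
      simpa using (((hasDerivAt_id τ).const_mul β).mul_const u).const_sub ((u - c) ^ 2)
    exact h.sqrt (by linarith)
  have hlin : HasDerivAt (fun τ => β * τ) β τ := by simpa using (hasDerivAt_id τ).const_mul β
  have hA := (hasDerivAt_id τ).mul (((hmid.add hsq).div_const 2).log
    (by show (e * (u - mid β c τ) + s) / 2 ≠ 0; positivity))
  have hB := (hasDerivAt_id τ).mul ((((hlin.log hβτ.ne').div_const 2).add
    (((hlin.add_const (4 * c)).log (by positivity)).div_const 2)).sub_const (Real.log 4))
  have hC := ((hsq.const_mul (-(2 / β))).add (((((hsq.const_add (u + c)).log hp1.ne').sub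
    ((hsq.const_sub (u + c)).log hp2.ne')).const_mul c).const_mul (2 / β))).const_mul e
  refine ((hA.sub hB).add hC).congr_deriv ?_
  rw [log_rad_half hβ hc hτ]
  simp only [Pi.add_apply, id_eq, ← hs]
  have hy : e * (u - mid β c τ) = e * (u - c - β * τ / 2) := by unfold mid; ring
  rw [hy] at hm ⊢
  set y := e * (u - c - β * τ / 2) with hydef
  -- This product, equal to `rad²`, and `hprod` clear the conjugate denominators `y + s` and `u + c
  -- ± s`.
  have hd2 : (y + s) * (y - s) = β * τ * (β * τ + 4 * c) / 4 := by
    linear_combination (y + e * (u - c - β * τ / 2)) * hydef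
      + (u - c - β * τ / 2) ^ 2 * he - hs2
  have hw : 0 < β * τ + 4 * c := by positivity
  have hys : 0 < y + s := by positivity
  have e1 : (-(e * (β / 2)) + -(β * u) / (2 * s)) / 2 / ((y + s) / 2)
      = -(2 * (e * s + u) * (y - s)) / (s * (τ * (β * τ + 4 * c))) := by
    rw [div_eq_div_iff (by positivity) (by positivity)]
    field_simp
    linear_combination (e * s + u) * 4 * hd2
  have e2 : -(β * u) / (2 * s) / (u + c + s) - -(-(β * u) / (2 * s)) / (u + c - s)
      = -(β * (u + c)) / (s * (β * τ + 4 * c)) := by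
    have : -(β * u) / (2 * s) / (u + c + s) - -(-(β * u) / (2 * s)) / (u + c - s)
      = -(β * u * (u + c)) / (s * ((u + c + s) * (u + c - s))) := by
      field_simp
      ring
    rw [this, hprod]
    field_simp
  rw [e1, e2]
  field_simp
  rw [hydef]
  linear_combination (-4 * s * (u - c - β * τ / 2)) * he + 4 * e * hs2

/-- Until the growing interval passes `u`, its midpoint stays on the same side of `u` as `c`, the
midpoint at `τ = 0`. Hence one sign `e` serves for all these `τ`. -/
lemma mul_mid_pos (hβ : 0 < β) (hc : 0 ≤ c) {u e τ : ℝ} (hu : 0 < u) (he : |u - c| = e * (u - c))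
    (he1 : e = 1 ∨ e = -1) (huc : u ≠ c) (hτ : 0 ≤ τ) (hD : β * τ * u ≤ (u - c) ^ 2) :
    0 < e * (u - mid β c τ) := by
  unfold mid
  have h0 : 0 < |u - c| := abs_pos.2 (sub_ne_zero.2 huc)
  rcases he1 with rfl | rfl
  · have h1 : 0 < u - c := by linarith
    by_contra hcon
    have h2 : u - c ≤ β * τ / 2 := by linarith
    nlinarith [mul_le_mul_of_nonneg_right h2 hu.le]
  · have h1 : 0 ≤ β * τ := by positivity
    linarith

lemma continuousOn_excessPrimitive (hβ : 0 < β) (hc : 0 ≤ c) {u e T : ℝ} (hu : 0 < u)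
    (he : |u - c| = e * (u - c)) (he1 : e = 1 ∨ e = -1) (huc : u ≠ c)
    (hT : β * T * u = (u - c) ^ 2) : ContinuousOn (excessPrimitive β c u e) (Icc 0 T) := by
  have hD : ∀ τ ∈ Icc 0 T, β * τ * u ≤ (u - c) ^ 2 := by
    intro τ hτ
    rw [← hT]
    have := hτ.2
    gcongr
  -- The logarithms may be singular at `τ = 0`; regrouping into terms `x log x` gives continuity
  -- there, and the leftover `4 c log (β τ + 4 c)` is zero when `c = 0`.
  have hlog : ContinuousOn (fun τ : ℝ => τ * (Real.log (β * τ) / 2 + Real.log (β * τ + 4 * c) / 2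
      - Real.log 4)) (Icc 0 T) := by
    have h1 : Continuous fun τ : ℝ => (β * τ) * Real.log (β * τ) :=
      Real.continuous_mul_log.comp (continuous_const.mul continuous_id)
    have h2 : Continuous fun τ : ℝ => (β * τ + 4 * c) * Real.log (β * τ + 4 * c) :=
      Real.continuous_mul_log.comp (by fun_prop : Continuous fun τ : ℝ => β * τ + 4 * c)
    have h3 : ContinuousOn (fun τ : ℝ => 4 * c * Real.log (β * τ + 4 * c)) (Icc 0 T) := by
      rcases hc.eq_or_lt with rfl | hc0
      · simp [continuousOn_const]
      · refine ContinuousOn.mul continuousOn_const (ContinuousOn.log (by fun_prop) ?_)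
        intro τ hτ
        have := hτ.1
        positivity
    refine ((((h1.add h2).continuousOn.sub h3).const_mul (1 / (2 * β))).sub
      ((continuous_id.mul continuous_const).continuousOn (f := fun τ => τ * Real.log 4))).congr ?_
    intro τ _
    simp only [Pi.sub_apply, Pi.add_apply]
    field_simp
    ring
  have hs : Continuous fun τ : ℝ => √((u - c) ^ 2 - β * τ * u) := by fun_prop
  have hsle : ∀ τ ∈ Icc 0 T, √((u - c) ^ 2 - β * τ * u) ≤ |u - c| := by
    intro τ hτ
    apply Real.sqrt_le_iff.2 ⟨abs_nonneg _, ?_⟩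
    rw [sq_abs]
    have : 0 ≤ β * τ * u := by have := hτ.1; positivity
    linarith
  have hmid : Continuous fun τ => e * (u - mid β c τ) := by unfold mid; fun_prop
  have hA : ContinuousOn (fun τ => τ * Real.log ((e * (u - mid β c τ)
      + √((u - c) ^ 2 - β * τ * u)) / 2)) (Icc 0 T) := by
    refine continuousOn_id.mul (((hmid.add hs).div_const 2).continuousOn.log fun τ hτ => ?_)
    have := mul_mid_pos hβ hc hu he he1 huc hτ.1 (hD τ hτ)
    have := Real.sqrt_nonneg ((u - c) ^ 2 - β * τ * u)
    simp only [Pi.add_apply]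
    positivity
  have hL1 : ContinuousOn (fun τ => Real.log (u + c + √((u - c) ^ 2 - β * τ * u))) (Icc 0 T) := by
    refine ContinuousOn.log (by fun_prop) fun τ _ => ?_
    positivity
  have hL : ContinuousOn (fun τ => c * (Real.log (u + c + √((u - c) ^ 2 - β * τ * u))
        - Real.log (u + c - √((u - c) ^ 2 - β * τ * u)))) (Icc 0 T) := by
    rcases hc.eq_or_lt with rfl | hc0
    · simp [continuousOn_const]
    · refine continuousOn_const.mul (hL1.sub (ContinuousOn.log (by fun_prop) fun τ hτ => ?_))
      have h1 := hsle τ hτ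
      have h2 : |u - c| < u + c := abs_lt.2 ⟨by linarith, by linarith⟩
      linarith
  unfold excessPrimitive
  exact (hA.sub hlog).add (((hs.const_mul _).continuousOn.add (hL.const_mul _)).const_mul e)

lemma integral_excess_of_eq (hβ : 0 < β) (hc : 0 ≤ c) {u T : ℝ} (hu : 0 < u) (huc : u ≠ c)
    (hT : β * T * u = (u - c) ^ 2) : IntervalIntegrable (excess β c u) volume 0 T ∧
      β / 2 * ∫ τ in 0..T, excess β c u τ = u - c - c * (Real.log u - Real.log c) := by
  obtain ⟨e, he1, he⟩ : ∃ e : ℝ, (e = 1 ∨ e = -1) ∧ |u - c| = e * (u - c) := by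
    rcases le_total 0 (u - c) with h | h
    · exact ⟨1, by simp, by simp [abs_of_nonneg h]⟩
    · exact ⟨-1, by simp, by simp [abs_of_nonpos h]⟩
  have hee : e * e = 1 := by rcases he1 with rfl | rfl <;> norm_num
  have habs : |e| = 1 := by rcases he1 with rfl | rfl <;> norm_num
  have hT0 : 0 < T := by
    have h1 : 0 < β * T * u := hT ▸ by have := sub_ne_zero.2 huc; positivity
    by_contra hcon
    have : β * T * u ≤ 0 := mul_nonpos_of_nonpos_of_nonneg
      (mul_nonpos_of_nonneg_of_nonpos hβ.le (not_lt.1 hcon)) hu.le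
    linarith
  have hcont := continuousOn_excessPrimitive hβ hc hu he he1 huc hT
  have hD : ∀ τ ∈ Ioo 0 T, β * τ * u < (u - c) ^ 2 := by
    intro τ hτ
    rw [← hT]
    have := hτ.2
    gcongr
  have hder : ∀ τ ∈ Ioo 0 T, HasDerivAt (excessPrimitive β c u e) (excess β c u τ) τ := by
    intro τ hτ
    have hm := mul_mid_pos hβ hc hu he he1 huc hτ.1.le (hD τ hτ).le
    rw [excess_eq hβ hc hτ.1.le (hD τ hτ).le]
    have : |u - mid β c τ| = e * (u - mid β c τ) := by
      rw [← abs_of_pos hm, abs_mul, habs, one_mul]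
    rw [this]
    exact hasDerivAt_excessPrimitive hβ hc hu hee hτ.1 (hD τ hτ) hm
  have hint : IntervalIntegrable (excess β c u) volume 0 T := by
    -- The excess blows up logarithmically as `τ` tends to `0`; a nonnegative derivative of a
    -- continuous function is nevertheless integrable.
    refine intervalIntegral.intervalIntegrable_deriv_of_nonneg (g := excessPrimitive β c u e) ?_ ?_ ?_
    · rwa [uIcc_of_le hT0.le]
    · rwa [min_eq_left hT0.le, max_eq_right hT0.le]
    · rw [min_eq_left hT0.le, max_eq_right hT0.le]
      exact fun τ hτ => excess_nonneg hβ hc u hτ.1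
  refine ⟨hint, ?_⟩
  rw [intervalIntegral.integral_eq_sub_of_hasDerivAt_of_le hT0.le hcont hder hint]
  -- At `τ = T` the point `u` is an endpoint of the interval: the square root vanishes and `|u -
  -- mid| = rad`.
  have hPT : excessPrimitive β c u e T = 0 := by
    have hm := mul_mid_pos hβ hc hu he he1 huc hT0.le hT.le
    have hr : e * (u - mid β c T) = rad β c T := by
      have h1 := sq_sub_mid_sub_rad_sq hβ hc u hT0.le
      have h2 : (e * (u - mid β c T)) ^ 2 = rad β c T ^ 2 := by
        rw [mul_pow, sq e, hee]
        linarith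
      exact (pow_left_inj₀ hm.le (rad_nonneg _ _ _) two_ne_zero).1 h2
    unfold excessPrimitive
    rw [hT, ← log_rad_half hβ hc hT0, hr]
    simp
  have hP0 : excessPrimitive β c u e 0
      = -(2 / β) * (u - c - c * (Real.log u - Real.log c)) := by
    unfold excessPrimitive
    simp only [mul_zero, zero_mul, sub_zero, zero_add, Real.sqrt_sq_eq_abs]
    -- The two arguments are twice the maximum and twice the minimum of `u` and `c`.
    have hlogs : e * (c * (Real.log (u + c + |u - c|) - Real.log (u + c - |u - c|)))
        = c * (Real.log u - Real.log c) := by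
      rcases hc.eq_or_lt with rfl | hc0
      · simp
      rcases he1 with rfl | rfl
      · rw [he, show u + c + 1 * (u - c) = 2 * u by ring, show u + c - 1 * (u - c) = 2 * c by ring,
          Real.log_mul two_ne_zero hu.ne', Real.log_mul two_ne_zero hc0.ne']
        ring
      · rw [he, show u + c + -1 * (u - c) = 2 * c by ring,
          show u + c - -1 * (u - c) = 2 * u by ring,
          Real.log_mul two_ne_zero hu.ne', Real.log_mul two_ne_zero hc0.ne']
        ring
    have h2 : e * |u - c| = u - c := by rw [he, ← mul_assoc, hee, one_mul]
    linear_combination (2 / β) * hlogs - (2 / β) * h2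
  rw [hPT, hP0]
  field_simp
  ring

/-- The Euler–Lagrange inequality, in the variable `u = t²`, with equality on the support. -/
theorem integral_excess (hβ : 0 < β) (hc : 0 ≤ c) {u : ℝ} (hu : 0 ≤ u) (huc : u = 0 → c = 0) :
    IntervalIntegrable (excess β c u) volume 0 1 ∧
      β / 2 * ∫ τ in 0..1, excess β c u τ ≤ u - c - c * (Real.log u - Real.log c) ∧
      ((u - c) ^ 2 ≤ β * u →
        β / 2 * ∫ τ in 0..1, excess β c u τ = u - c - c * (Real.log u - Real.log c)) := by
  -- The point `c` belongs to every interval, so its excess is zero. The excluded case `u = 0 < c`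
  -- is the one where the default `Real.log 0 = 0` replaces an infinite right-hand side.
  by_cases hcu : u = c
  · have h0 : EqOn (fun _ => (0 : ℝ)) (excess β c u) (uIoc 0 1) := by
      intro τ hτ
      rw [uIoc_of_le zero_le_one] at hτ
      have h1 : 0 ≤ β * τ * u := by have := hτ.1; positivity
      exact (excess_eq_zero hβ hc hτ.1.le (by rw [hcu] at h1 ⊢; simpa using h1)).symm
    have hi : IntervalIntegrable (excess β c u) volume 0 1 :=
      intervalIntegrable_const.congr h0
    have : ∫ τ in 0..1, excess β c u τ = 0 := by
      rw [← intervalIntegral.integral_congr_ae (Eventually.of_forall h0)]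
      simp
    refine ⟨hi, ?_, fun _ => ?_⟩ <;> rw [this, hcu] <;> simp
  have hu0 : 0 < u := hu.lt_of_ne fun h => hcu (by rw [huc h.symm, h])
  set T := (u - c) ^ 2 / (β * u) with hTdef
  have hT : β * T * u = (u - c) ^ 2 := by rw [hTdef]; field_simp
  have hT0 : 0 ≤ T := by positivity
  obtain ⟨hi, hv⟩ := integral_excess_of_eq hβ hc hu0 hcu hT
  rcases le_total T 1 with h1 | h1
  · have h0 : EqOn (fun _ => (0 : ℝ)) (excess β c u) (uIoc T 1) := by
      intro τ hτ
      rw [uIoc_of_le h1] at hτ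
      refine (excess_eq_zero hβ hc (hT0.trans hτ.1.le) ?_).symm
      rw [← hT]
      have := hτ.1.le
      gcongr
    have hi2 : IntervalIntegrable (excess β c u) volume T 1 :=
      intervalIntegrable_const.congr h0
    have hz : ∫ τ in T..1, excess β c u τ = 0 := by
      rw [← intervalIntegral.integral_congr_ae (Eventually.of_forall h0)]
      simp
    have hsum := intervalIntegral.integral_add_adjacent_intervals hi hi2
    rw [hz, add_zero] at hsum
    rw [← hsum]
    exact ⟨hi.trans hi2, hv.le, fun _ => hv⟩
  · refine ⟨hi.mono_set ?_, ?_, fun h => ?_⟩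
    · rw [uIcc_of_le zero_le_one, uIcc_of_le hT0]
      exact Icc_subset_Icc_right h1
    · rw [← hv]
      gcongr
      refine intervalIntegral.integral_mono_interval le_rfl zero_le_one h1 ?_ hi
      filter_upwards [ae_restrict_mem measurableSet_Ioc] with τ hτ
      exact excess_nonneg hβ hc u hτ.1
    · have : T = 1 := le_antisymm ((div_le_one (by positivity)).2 h) h1
      rw [← this]
      exact hv

end

/-! ### The equilibrium measure -/

/-- The uniform law of the pairs (mass, angle). -/
noncomputable def paramMeasure : Measure (ℝ × ℝ) :=
  (volume.restrict (Ioc (0 : ℝ) 1)).prod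
    (ENNReal.ofReal (2 * Real.pi)⁻¹ • volume.restrict (Ioc (0 : ℝ) (2 * Real.pi)))

/-- The square of a point of the support, from the mass and the angle. -/
noncomputable def sqPoint (β c : ℝ) (p : ℝ × ℝ) : ℝ := mid β c p.1 + rad β c p.1 * Real.cos p.2

/-- The equilibrium measure: the symmetric law whose image under squaring is a mixture of arcsine
laws. -/
noncomputable def eqMeasure (β c : ℝ) : Measure ℝ :=
  (2⁻¹ : ℝ≥0∞) • paramMeasure.map (fun p => √(sqPoint β c p))
    + (2⁻¹ : ℝ≥0∞) • paramMeasure.map (fun p => -√(sqPoint β c p))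

instance isProbabilityMeasure_angle : IsProbabilityMeasure
    (ENNReal.ofReal (2 * Real.pi)⁻¹ • volume.restrict (Ioc (0 : ℝ) (2 * Real.pi))) := by
  constructor
  have := Real.pi_pos
  rw [Measure.smul_apply, Measure.restrict_apply_univ, Real.volume_Ioc, smul_eq_mul,
    ← ENNReal.ofReal_mul (by positivity), sub_zero, inv_mul_cancel₀ (by positivity),
    ENNReal.ofReal_one]

instance isProbabilityMeasure_mass : IsProbabilityMeasure (volume.restrict (Ioc (0 : ℝ) 1)) := by
  constructor
  simp

instance isProbabilityMeasure_paramMeasure : IsProbabilityMeasure paramMeasure := by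
  unfold paramMeasure; infer_instance

section

variable {β c : ℝ}

lemma continuous_sqPoint (β c : ℝ) : Continuous (sqPoint β c) := by
  unfold sqPoint mid rad
  fun_prop

lemma integral_angle (f : ℝ → ℝ) :
    ∫ θ, f θ ∂(ENNReal.ofReal (2 * Real.pi)⁻¹ • volume.restrict (Ioc (0 : ℝ) (2 * Real.pi)))
      = (2 * Real.pi)⁻¹ * ∫ θ in 0..2 * Real.pi, f θ := by
  have := Real.pi_pos
  rw [integral_smul_measure, ENNReal.toReal_ofReal (by positivity),
    intervalIntegral.integral_of_le (by positivity), smul_eq_mul]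

lemma integrable_angle {f : ℝ → ℝ} (hf : IntervalIntegrable f volume 0 (2 * Real.pi)) :
    Integrable f (ENNReal.ofReal (2 * Real.pi)⁻¹ • volume.restrict (Ioc (0 : ℝ) (2 * Real.pi))) :=
  ((intervalIntegrable_iff_integrableOn_Ioc_of_le (by have := Real.pi_pos; positivity)).1
    hf).integrable.smul_measure ENNReal.ofReal_ne_top

lemma ae_fst_mem : ∀ᵐ p : ℝ × ℝ ∂paramMeasure, p.1 ∈ Ioc (0 : ℝ) 1 :=
  Measure.quasiMeasurePreserving_fst.ae (ae_restrict_mem measurableSet_Ioc)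

lemma sqPoint_nonneg (hβ : 0 < β) (hc : 0 ≤ c) {p : ℝ × ℝ} (hp : p.1 ∈ Ioc (0 : ℝ) 1) :
    0 ≤ sqPoint β c p := by
  have h1 := rad_le_mid hβ hc hp.1.le
  have h2 := rad_nonneg β c p.1
  have h3 := Real.neg_one_le_cos p.2
  unfold sqPoint
  nlinarith

lemma sqPoint_le (hβ : 0 < β) (hc : 0 ≤ c) {p : ℝ × ℝ} (hp : p.1 ∈ Ioc (0 : ℝ) 1) :
    sqPoint β c p ≤ 2 * c + β := by
  have h1 := rad_le_mid hβ hc hp.1.le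
  have h2 := rad_nonneg β c p.1
  have h3 := Real.cos_le_one p.2
  have h4 : mid β c p.1 ≤ c + β / 2 := by
    have := hp.2
    unfold mid
    nlinarith
  unfold sqPoint
  nlinarith

/-- The intervals increase with the mass, so all of them lie in the one for `τ = 1`, where the
Euler–Lagrange equality is available. -/
lemma sq_sqPoint_sub_le (hβ : 0 < β) (hc : 0 ≤ c) {p : ℝ × ℝ} (hp : p.1 ∈ Ioc (0 : ℝ) 1) :
    (sqPoint β c p - c) ^ 2 ≤ β * sqPoint β c p := by
  have h0 := sqPoint_nonneg hβ hc hp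
  have h1 := sq_sub_mid_sub_rad_sq hβ hc (sqPoint β c p) hp.1.le
  have h2 : (sqPoint β c p - mid β c p.1) ^ 2 ≤ rad β c p.1 ^ 2 := by
    have h3 : sqPoint β c p - mid β c p.1 = rad β c p.1 * Real.cos p.2 := by unfold sqPoint; ring
    rw [h3, mul_pow]
    exact mul_le_of_le_one_right (sq_nonneg _) (Real.cos_sq_le_one _)
  have h4 : β * p.1 * sqPoint β c p ≤ β * 1 * sqPoint β c p := by
    have := hp.2
    gcongr
  linarith

lemma ae_cos_ne (a : ℝ) : ∀ᵐ θ : ℝ, Real.cos θ ≠ a := by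
  suffices h : {θ : ℝ | Real.cos θ = a}.Countable from h.ae_notMem volume
  by_cases ha : ∃ θ₀, Real.cos θ₀ = a
  · obtain ⟨θ₀, rfl⟩ := ha
    refine ((countable_range fun k : ℤ => 2 * k * Real.pi + θ₀).union
      (countable_range fun k : ℤ => 2 * k * Real.pi - θ₀)).mono ?_
    intro θ hθ
    obtain ⟨k, h | h⟩ := Real.cos_eq_cos_iff.1 (Eq.symm hθ)
    · exact Or.inl ⟨k, h.symm⟩
    · exact Or.inr ⟨k, h.symm⟩
  · refine countable_empty.mono fun θ hθ => ha ⟨θ, hθ⟩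

lemma ae_sqPoint_ne (hβ : 0 < β) (hc : 0 ≤ c) (w : ℝ) :
    ∀ᵐ p ∂paramMeasure, sqPoint β c p ≠ w := by
  unfold paramMeasure
  refine (Measure.ae_prod_iff_ae_ae (p := fun p => sqPoint β c p ≠ w)
    ((measurableSet_singleton w).compl.preimage (continuous_sqPoint β c).measurable)).2 ?_
  filter_upwards [ae_restrict_mem measurableSet_Ioc] with τ hτ
  have hd := rad_pos hβ hc hτ.1
  refine Measure.smul_absolutelyContinuous.ae_le (ae_restrict_of_ae ?_)
  filter_upwards [ae_cos_ne ((w - mid β c τ) / rad β c τ)] with θ hθ h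
  apply hθ
  rw [eq_div_iff hd.ne', ← h]
  simp only [sqPoint]
  ring

lemma intervalIntegrable_log_mul_add (hβ : 0 < β) (k : ℝ) :
    IntervalIntegrable (fun τ => Real.log (β * τ + k)) volume 0 1 := by
  have h := ((intervalIntegral.intervalIntegrable_log' (a := k) (b := β + k)).comp_add_right
    k).comp_mul_left (c := β)
  simpa [hβ.ne'] using h

lemma integral_log_mul_add (hβ : 0 < β) (k : ℝ) :
    ∫ τ in 0..1, Real.log (β * τ + k)
      = ((β + k) * Real.log (β + k) - k * Real.log k) / β - 1 := by
  rw [intervalIntegral.integral_comp_mul_add _ hβ.ne', integral_log]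
  simp only [mul_one, mul_zero, zero_add, smul_eq_mul]
  field_simp
  ring

lemma log_rad_half_integral (hβ : 0 < β) (hc : 0 ≤ c) :
    IntervalIntegrable (fun τ => Real.log (rad β c τ / 2)) volume 0 1 ∧
    ∫ τ in 0..1, Real.log (rad β c τ / 2) = (Real.log β - 1) / 2
      + (((β + 4 * c) * Real.log (β + 4 * c) - 4 * c * Real.log (4 * c)) / β - 1) / 2
      - Real.log 4 := by
  have h1 := intervalIntegrable_log_mul_add hβ 0
  have h2 := intervalIntegrable_log_mul_add hβ (4 * c)
  have v1 := integral_log_mul_add hβ 0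
  have v2 := integral_log_mul_add hβ (4 * c)
  simp only [add_zero] at h1 v1
  have h3 := ((h1.div_const 2).add (h2.div_const 2)).sub
    (intervalIntegrable_const (c := Real.log 4))
  have he : EqOn (fun τ => Real.log (β * τ) / 2 + Real.log (β * τ + 4 * c) / 2 - Real.log 4)
      (fun τ => Real.log (rad β c τ / 2)) (uIoc 0 1) := by
    intro τ hτ
    rw [uIoc_of_le zero_le_one] at hτ
    exact (log_rad_half hβ hc hτ.1).symm
  refine ⟨h3.congr he, ?_⟩
  rw [← intervalIntegral.integral_congr_ae (Eventually.of_forall he),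
    intervalIntegral.integral_sub ((h1.div_const 2).add (h2.div_const 2)) intervalIntegrable_const,
    intervalIntegral.integral_add (h1.div_const 2) (h2.div_const 2),
    intervalIntegral.integral_div, intervalIntegral.integral_div, v1, v2]
  simp
  field_simp

lemma integral_angle_log (hβ : 0 < β) (hc : 0 ≤ c) (w : ℝ) {τ : ℝ} (hτ : 0 < τ) :
    Integrable (fun θ => Real.log |w - sqPoint β c (τ, θ)|)
      (ENNReal.ofReal (2 * Real.pi)⁻¹ • volume.restrict (Ioc (0 : ℝ) (2 * Real.pi))) ∧
    ∫ θ, Real.log |w - sqPoint β c (τ, θ)|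
      ∂(ENNReal.ofReal (2 * Real.pi)⁻¹ • volume.restrict (Ioc (0 : ℝ) (2 * Real.pi)))
      = excess β c w τ + Real.log (rad β c τ / 2) := by
  obtain ⟨h1, h2⟩ := intervalIntegral_log_abs_sub_mul_cos (w - mid β c τ) (rad_pos hβ hc hτ)
  have he : ∀ θ, w - mid β c τ - rad β c τ * Real.cos θ = w - sqPoint β c (τ, θ) := by
    intro θ; simp only [sqPoint]; ring
  simp only [he] at h1 h2
  refine ⟨integrable_angle h1, ?_⟩
  rw [integral_angle, h2, excess, sub_add_cancel]

/-- An upper bound `M ≥ 0` for a logarithm `L` gives `|L| ≤ 2 M - L`, so absolute integrability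
follows from the signed integral. -/
lemma abs_log_abs_sub_sqPoint_le (hβ : 0 < β) (hc : 0 ≤ c) {w : ℝ} (hw : 0 ≤ w) {p : ℝ × ℝ}
    (hp : p.1 ∈ Ioc (0 : ℝ) 1) : |Real.log (|w - sqPoint β c p|)|
      ≤ 2 * (w + 2 * c + β) - Real.log |w - sqPoint β c p| := by
  have h1 := sqPoint_nonneg hβ hc hp
  have h2 := sqPoint_le hβ hc hp
  have h3 : Real.log |w - sqPoint β c p| ≤ w + 2 * c + β :=
    (Real.log_le_self (abs_nonneg _)).trans (abs_le.2 ⟨by linarith, by linarith⟩)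
  exact abs_le.2 ⟨by linarith, by linarith⟩

/-- The potential of the image of the equilibrium measure under squaring. -/
theorem integral_log_abs_sub_sqPoint (hβ : 0 < β) (hc : 0 ≤ c) {w : ℝ} (hw : 0 ≤ w) :
    Integrable (fun p => Real.log |w - sqPoint β c p|) paramMeasure ∧
    ∫ p, Real.log |w - sqPoint β c p| ∂paramMeasure
      = ∫ τ in 0..1, (excess β c w τ + Real.log (rad β c τ / 2)) ∧
    ∫ p, |Real.log (|w - sqPoint β c p|)| ∂paramMeasure
      ≤ 2 * (w + 2 * c + β) - ∫ τ in 0..1, Real.log (rad β c τ / 2) := by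
  have hm : Measurable (fun p => Real.log |w - sqPoint β c p|) := by
    have := (continuous_sqPoint β c).measurable
    fun_prop
  have hr : IntegrableOn (fun τ => Real.log (rad β c τ / 2)) (Ioc 0 1) :=
    (intervalIntegrable_iff_integrableOn_Ioc_of_le zero_le_one).1 (log_rad_half_integral hβ hc).1
  have hbi : IntegrableOn (fun τ => 2 * (w + 2 * c + β) - Real.log (rad β c τ / 2)) (Ioc 0 1) :=
    (integrable_const _).sub hr
  have hb : ∀ τ ∈ Ioc (0 : ℝ) 1, ∫ θ, |Real.log (|w - sqPoint β c (τ, θ)|)|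
      ∂(ENNReal.ofReal (2 * Real.pi)⁻¹ • volume.restrict (Ioc (0 : ℝ) (2 * Real.pi)))
      ≤ 2 * (w + 2 * c + β) - Real.log (rad β c τ / 2) := by
    intro τ hτ
    obtain ⟨h1, h2⟩ := integral_angle_log hβ hc w hτ.1
    calc _ ≤ ∫ θ, (2 * (w + 2 * c + β) - Real.log (|w - sqPoint β c (τ, θ)|))
          ∂(ENNReal.ofReal (2 * Real.pi)⁻¹ • volume.restrict (Ioc (0 : ℝ) (2 * Real.pi))) :=
          integral_mono h1.norm ((integrable_const _).sub h1)
            fun θ => abs_log_abs_sub_sqPoint_le hβ hc hw (p := (τ, θ)) hτ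
      _ = 2 * (w + 2 * c + β) - (excess β c w τ + Real.log (rad β c τ / 2)) := by
          rw [integral_sub (integrable_const _) h1, h2, integral_const, probReal_univ, one_smul]
      _ ≤ _ := by have := excess_nonneg hβ hc w hτ.1; linarith
  have hint : Integrable (fun p => Real.log |w - sqPoint β c p|) paramMeasure := by
    unfold paramMeasure
    rw [integrable_prod_iff hm.aestronglyMeasurable]
    refine ⟨?_, hbi.mono' hm.aestronglyMeasurable.norm.integral_prod_right' ?_⟩
    · filter_upwards [ae_restrict_mem measurableSet_Ioc] with τ hτ
      exact (integral_angle_log hβ hc w hτ.1).1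
    · filter_upwards [ae_restrict_mem measurableSet_Ioc] with τ hτ
      rw [Real.norm_of_nonneg (integral_nonneg fun _ => norm_nonneg _)]
      exact hb τ hτ
  refine ⟨hint, ?_, ?_⟩
  · unfold paramMeasure at hint ⊢
    rw [integral_prod _ hint, intervalIntegral.integral_of_le zero_le_one]
    exact setIntegral_congr_fun measurableSet_Ioc fun τ hτ => (integral_angle_log hβ hc w hτ.1).2
  · have hn := hint.norm
    unfold paramMeasure at hn ⊢
    have h3 : ∫ τ in Ioc (0 : ℝ) 1, (2 * (w + 2 * c + β) - Real.log (rad β c τ / 2))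
        = 2 * (w + 2 * c + β) - ∫ τ in 0..1, Real.log (rad β c τ / 2) := by
      rw [integral_sub (integrable_const _) hr, intervalIntegral.integral_of_le zero_le_one]
      simp
    rw [← h3]
    simp only [Real.norm_eq_abs] at hn
    rw [integral_prod _ hn]
    exact setIntegral_mono_on hn.integral_prod_left hbi measurableSet_Ioc hb

end

/-! ### Moments and logarithmic potential of the equilibrium measure on the line -/

section

variable {β c : ℝ}

lemma measurable_sqrt_sqPoint (β c : ℝ) : Measurable (fun p => √(sqPoint β c p)) :=
  (Real.continuous_sqrt.comp (continuous_sqPoint β c)).measurable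

instance isProbabilityMeasure_eqMeasure (β c : ℝ) : IsProbabilityMeasure (eqMeasure β c) := by
  have h1 := Measure.isProbabilityMeasure_map (μ := paramMeasure)
    (measurable_sqrt_sqPoint β c).aemeasurable
  have h2 := Measure.isProbabilityMeasure_map (μ := paramMeasure)
    (measurable_sqrt_sqPoint β c).neg.aemeasurable
  constructor
  unfold eqMeasure
  have h3 : (paramMeasure.map (fun p => -√(sqPoint β c p))) univ = 1 := h2.measure_univ
  simp only [Measure.coe_add, Measure.coe_smul, Pi.add_apply, Pi.smul_apply, measure_univ, h3]
  simp [ENNReal.inv_two_add_inv_two]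

lemma ae_eqMeasure {q : ℝ → Prop} (hq : MeasurableSet {s | q s})
    (h : ∀ᵐ p ∂paramMeasure, q (√(sqPoint β c p)) ∧ q (-√(sqPoint β c p))) :
    ∀ᵐ s ∂eqMeasure β c, q s := by
  unfold eqMeasure
  rw [ae_add_measure_iff]
  refine ⟨Measure.smul_absolutelyContinuous.ae_le ?_, Measure.smul_absolutelyContinuous.ae_le ?_⟩
  · exact (ae_map_iff (measurable_sqrt_sqPoint β c).aemeasurable hq).2 (h.mono fun _ h => h.1)
  · exact (ae_map_iff (measurable_sqrt_sqPoint β c).neg.aemeasurable hq).2 (h.mono fun _ h => h.2)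

lemma integrable_eqMeasure {f : ℝ → ℝ} (hf : Measurable f)
    (h1 : Integrable (fun p => f (√(sqPoint β c p))) paramMeasure)
    (h2 : Integrable (fun p => f (-√(sqPoint β c p))) paramMeasure) :
    Integrable f (eqMeasure β c) ∧ ∫ s, f s ∂eqMeasure β c
      = (∫ p, (f (√(sqPoint β c p)) + f (-√(sqPoint β c p))) ∂paramMeasure) / 2 := by
  have m1 := (measurable_sqrt_sqPoint β c).aemeasurable (μ := paramMeasure)
  have m2 := (measurable_sqrt_sqPoint β c).neg.aemeasurable (μ := paramMeasure)
  have i1 : Integrable f (paramMeasure.map (fun p => √(sqPoint β c p))) :=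
    (integrable_map_measure hf.aestronglyMeasurable m1).2 h1
  have i2 : Integrable f (paramMeasure.map (fun p => -√(sqPoint β c p))) :=
    (integrable_map_measure hf.aestronglyMeasurable m2).2 h2
  have j1 := i1.smul_measure (c := 2⁻¹) (by simp)
  have j2 := i2.smul_measure (c := 2⁻¹) (by simp)
  refine ⟨integrable_add_measure.2 ⟨j1, j2⟩, ?_⟩
  have e2 : ∫ s, f s ∂(paramMeasure.map (fun p => -√(sqPoint β c p)))
      = ∫ p, f (-√(sqPoint β c p)) ∂paramMeasure := integral_map m2 hf.aestronglyMeasurable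
  unfold eqMeasure
  rw [integral_add_measure j1 j2, integral_smul_measure, integral_smul_measure,
    integral_map m1 hf.aestronglyMeasurable, e2, integral_add h1 h2]
  simp
  ring

lemma integrable_sqPoint (hβ : 0 < β) (hc : 0 ≤ c) :
    Integrable (sqPoint β c) paramMeasure ∧ ∫ p, sqPoint β c p ∂paramMeasure = c + β / 4 := by
  have hi : Integrable (sqPoint β c) paramMeasure := by
    refine Integrable.of_bound (continuous_sqPoint β c).aestronglyMeasurable (2 * c + β) ?_
    filter_upwards [ae_fst_mem] with p hp
    rw [Real.norm_of_nonneg (sqPoint_nonneg hβ hc hp)]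
    exact sqPoint_le hβ hc hp
  refine ⟨hi, ?_⟩
  unfold paramMeasure at hi ⊢
  rw [integral_prod _ hi]
  have : ∀ τ, ∫ θ, sqPoint β c (τ, θ)
      ∂(ENNReal.ofReal (2 * Real.pi)⁻¹ • volume.restrict (Ioc (0 : ℝ) (2 * Real.pi)))
      = mid β c τ := by
    intro τ
    rw [integral_angle]
    simp only [sqPoint]
    rw [intervalIntegral.integral_add intervalIntegrable_const
      ((Real.continuous_cos.intervalIntegrable _ _).const_mul _),
      intervalIntegral.integral_const_mul, integral_cos]
    have := Real.pi_pos
    simp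
    field_simp
  simp only [this]
  rw [← intervalIntegral.integral_of_le zero_le_one]
  simp only [mid]
  rw [intervalIntegral.integral_add intervalIntegrable_const
      ((by fun_prop : Continuous fun τ : ℝ => β * τ / 2).intervalIntegrable _ _),
    intervalIntegral.integral_div, intervalIntegral.integral_const_mul, integral_id]
  simp
  ring

lemma integrable_sq_eqMeasure (hβ : 0 < β) (hc : 0 ≤ c) :
    Integrable (fun s => s ^ 2) (eqMeasure β c) ∧ ∫ s, s ^ 2 ∂eqMeasure β c = c + β / 4 := by
  obtain ⟨h1, h2⟩ := integrable_sqPoint hβ hc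
  have he : sqPoint β c =ᵐ[paramMeasure] fun p => √(sqPoint β c p) ^ 2 := by
    filter_upwards [ae_fst_mem] with p hp
    exact (Real.sq_sqrt (sqPoint_nonneg hβ hc hp)).symm
  have h3 : Integrable (fun p => √(sqPoint β c p) ^ 2) paramMeasure := h1.congr he
  obtain ⟨h4, h5⟩ := integrable_eqMeasure (β := β) (c := c) (f := fun s => s ^ 2) (by fun_prop) h3
    (by simpa only [neg_sq] using h3)
  refine ⟨h4, ?_⟩
  rw [h5, ← h2, ← integral_div]
  refine integral_congr_ae ?_
  filter_upwards [he] with p hp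
  rw [neg_sq, ← hp]
  ring

lemma ae_eqMeasure_ne (hβ : 0 < β) (hc : 0 ≤ c) (x : ℝ) : ∀ᵐ s ∂eqMeasure β c, x ≠ s := by
  refine ae_eqMeasure ((measurableSet_singleton x).compl.congr (by ext; simp [eq_comm])) ?_
  filter_upwards [ae_sqPoint_ne hβ hc (x ^ 2), ae_fst_mem] with p hp hp'
  have := Real.sq_sqrt (sqPoint_nonneg hβ hc hp')
  constructor
  · rintro rfl
    exact hp this.symm
  · rintro rfl
    rw [neg_sq] at hp
    exact hp this.symm

/-- The logarithmic potential of the equilibrium measure. -/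
theorem integral_log_abs_sub_eqMeasure (hβ : 0 < β) (hc : 0 ≤ c) (x : ℝ) :
    Integrable (fun s => Real.log |x - s|) (eqMeasure β c) ∧
    ∫ s, Real.log |x - s| ∂eqMeasure β c
      = (∫ τ in 0..1, (excess β c (x ^ 2) τ + Real.log (rad β c τ / 2))) / 2 ∧
    ∫ s, |Real.log (|x - s|)| ∂eqMeasure β c
      ≤ 2 * (x ^ 2 + 2 * c + β) - (∫ τ in 0..1, Real.log (rad β c τ / 2))
        + (|x| + 1 + 2 * c + β) := by
  obtain ⟨h1, h2, h3⟩ := integral_log_abs_sub_sqPoint hβ hc (sq_nonneg x)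
  have hm : Measurable (fun s => Real.log |x - s|) := by fun_prop
  have hX := measurable_sqrt_sqPoint β c
  -- By symmetry, the potential at `x` is half of the potential at `x²` of the image under squaring.
  have hsum : ∀ᵐ p ∂paramMeasure, Real.log |x - √(sqPoint β c p)| + Real.log |x - -√(sqPoint β c p)|
      = Real.log |x ^ 2 - sqPoint β c p| := by
    filter_upwards [ae_sqPoint_ne hβ hc (x ^ 2), ae_fst_mem] with p hp hp'
    have hsq := Real.sq_sqrt (sqPoint_nonneg hβ hc hp')
    have hf : x ^ 2 - sqPoint β c p = (x - √(sqPoint β c p)) * (x - -√(sqPoint β c p)) := by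
      linear_combination hsq
    have hne : (x - √(sqPoint β c p)) * (x - -√(sqPoint β c p)) ≠ 0 :=
      hf ▸ sub_ne_zero.2 hp.symm
    rw [hf, abs_mul, Real.log_mul (abs_ne_zero.2 (left_ne_zero_of_mul hne))
      (abs_ne_zero.2 (right_ne_zero_of_mul hne))]
  have hle : ∀ᵐ p ∂paramMeasure, Real.log |x - √(sqPoint β c p)| ≤ |x| + 1 + 2 * c + β ∧
      Real.log |x - -√(sqPoint β c p)| ≤ |x| + 1 + 2 * c + β := by
    filter_upwards [ae_fst_mem] with p hp
    have h0 := Real.sqrt_nonneg (sqPoint β c p)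
    have hu : √(sqPoint β c p) ≤ 1 + 2 * c + β := by
      have := sqPoint_le hβ hc hp
      have := Real.sq_sqrt (sqPoint_nonneg hβ hc hp)
      nlinarith [sq_nonneg (√(sqPoint β c p) - 1)]
    constructor
    · refine (Real.log_le_self (abs_nonneg _)).trans ((abs_sub _ _).trans ?_)
      rw [abs_of_nonneg h0]; linarith
    · refine (Real.log_le_self (abs_nonneg _)).trans ((abs_sub _ _).trans ?_)
      rw [abs_neg, abs_of_nonneg h0]; linarith
  have hB : 0 ≤ |x| + 1 + 2 * c + β := by positivity
  -- Each logarithm is bounded above, hence bounded below by the sum minus the bound on the other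
  -- one.
  have hab : ∀ᵐ p ∂paramMeasure,
      |Real.log (|x - √(sqPoint β c p)|)|
        ≤ |Real.log (|x ^ 2 - sqPoint β c p|)| + (|x| + 1 + 2 * c + β) ∧
      |Real.log (|x - -√(sqPoint β c p)|)|
        ≤ |Real.log (|x ^ 2 - sqPoint β c p|)| + (|x| + 1 + 2 * c + β) := by
    filter_upwards [hsum, hle] with p hs hl
    rw [← hs]
    have h4 := neg_abs_le (Real.log |x - √(sqPoint β c p)| + Real.log |x - -√(sqPoint β c p)|)
    have h5 := abs_nonneg (Real.log |x - √(sqPoint β c p)| + Real.log |x - -√(sqPoint β c p)|)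
    constructor <;> refine abs_le.2 ⟨?_, ?_⟩ <;> linarith [hl.1, hl.2]
  have hBi : Integrable (fun p => |Real.log (|x ^ 2 - sqPoint β c p|)| + (|x| + 1 + 2 * c + β))
      paramMeasure := h1.abs.add (integrable_const _)
  have i1 : Integrable (fun p => Real.log |x - √(sqPoint β c p)|) paramMeasure :=
    hBi.mono' (Measurable.aestronglyMeasurable (by fun_prop)) (hab.mono fun _ h => h.1)
  have i2 : Integrable (fun p => Real.log |x - -√(sqPoint β c p)|) paramMeasure :=
    hBi.mono' (Measurable.aestronglyMeasurable (by fun_prop)) (hab.mono fun _ h => h.2)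
  obtain ⟨h6, h7⟩ := integrable_eqMeasure hm i1 i2
  refine ⟨h6, ?_, ?_⟩
  · rw [h7, ← h2, integral_congr_ae hsum]
  · obtain ⟨-, h8⟩ := integrable_eqMeasure hm.abs i1.abs i2.abs
    rw [h8, div_le_iff₀ two_pos]
    calc _ ≤ ∫ p, (2 * (|Real.log (|x ^ 2 - sqPoint β c p|)| + (|x| + 1 + 2 * c + β)))
          ∂paramMeasure := by
          refine integral_mono_ae (i1.abs.add i2.abs) (hBi.const_mul 2) ?_
          filter_upwards [hab] with p hp
          linarith [hp.1, hp.2]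
      _ = 2 * (∫ p, |Real.log (|x ^ 2 - sqPoint β c p|)| ∂paramMeasure
          + (|x| + 1 + 2 * c + β)) := by
          rw [integral_const_mul, integral_add h1.abs (integrable_const _), integral_const,
            probReal_univ, one_smul]
      _ ≤ _ := by linarith

lemma integrable_log_abs_sub_prod (hβ : 0 < β) (hc : 0 ≤ c) (ν : Measure ℝ) [IsProbabilityMeasure ν]
    (hν : Integrable (fun x => x) ν) (hν2 : Integrable (fun x => x ^ 2) ν) :
    Integrable (fun p : ℝ × ℝ => Real.log |p.1 - p.2|) (ν.prod (eqMeasure β c)) := by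
  have hm : Measurable (fun p : ℝ × ℝ => Real.log |p.1 - p.2|) := by fun_prop
  rw [integrable_prod_iff hm.aestronglyMeasurable]
  refine ⟨Eventually.of_forall fun x => (integral_log_abs_sub_eqMeasure hβ hc x).1, ?_⟩
  refine Integrable.mono' (g := fun x => 2 * (x ^ 2 + 2 * c + β)
    - (∫ τ in 0..1, Real.log (rad β c τ / 2)) + (|x| + 1 + 2 * c + β)) ?_
    hm.aestronglyMeasurable.norm.integral_prod_right' (Eventually.of_forall fun x => ?_)
  · have := hν.abs
    fun_prop
  · rw [Real.norm_of_nonneg (integral_nonneg fun _ => norm_nonneg _)]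
    exact (integral_log_abs_sub_eqMeasure hβ hc x).2.2

/-- Euler–Lagrange conditions for the equilibrium measure. -/
theorem mul_potential_le (hβ : 0 < β) (hc : 0 ≤ c) {x : ℝ} (hx : x = 0 → c = 0) :
    β * ∫ s, Real.log |x - s| ∂eqMeasure β c
      ≤ x ^ 2 - 2 * c * Real.log |x| - (c - c * Real.log c
        - β / 2 * ∫ τ in 0..1, Real.log (rad β c τ / 2)) ∧
    ((x ^ 2 - c) ^ 2 ≤ β * x ^ 2 → β * ∫ s, Real.log |x - s| ∂eqMeasure β c
      = x ^ 2 - 2 * c * Real.log |x| - (c - c * Real.log c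
        - β / 2 * ∫ τ in 0..1, Real.log (rad β c τ / 2))) := by
  obtain ⟨h1, h2, h3⟩ := integral_excess hβ hc (sq_nonneg x) (fun h => hx (pow_eq_zero_iff two_ne_zero |>.1 h))
  rw [(integral_log_abs_sub_eqMeasure hβ hc x).2.1,
    intervalIntegral.integral_add h1 (log_rad_half_integral hβ hc).1]
  have : Real.log (x ^ 2) = 2 * Real.log |x| := by rw [← sq_abs, Real.log_pow]; norm_num
  rw [this] at h2 h3
  exact ⟨by linarith, fun h => by linarith [h3 h]⟩

/-- This is the potential at `0`. Since `0` is interior to none of the intervals, the outer formula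
for the arcsine potential applies for every `τ` and reduces to `log ((β τ + 4 c) / 4)`. -/
lemma integral_log_abs_eqMeasure (hβ : 0 < β) (hc : 0 ≤ c) :
    Integrable (fun s => Real.log |s|) (eqMeasure β c) ∧
    ∫ s, Real.log |s| ∂eqMeasure β c
      = ((((β + 4 * c) * Real.log (β + 4 * c) - 4 * c * Real.log (4 * c)) / β - 1)
        - Real.log 4) / 2 := by
  obtain ⟨h1, h2, -⟩ := integral_log_abs_sub_eqMeasure hβ hc 0
  simp only [zero_sub, abs_neg] at h1 h2
  refine ⟨h1, ?_⟩
  have he : EqOn (fun τ => excess β c (0 ^ 2) τ + Real.log (rad β c τ / 2))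
      (fun τ => Real.log (β * τ + 4 * c) - Real.log 4) (uIoc 0 1) := by
    intro τ hτ
    rw [uIoc_of_le zero_le_one] at hτ
    have := hτ.1
    simp only
    rw [excess_eq hβ hc hτ.1.le (by simp [sq_nonneg]), sub_add_cancel,
      ← Real.log_div (by positivity) (by norm_num)]
    congr 1
    have h4 : √((0 ^ 2 - c) ^ 2 - β * τ * 0 ^ 2) = c := by
      rw [show ((0 : ℝ) ^ 2 - c) ^ 2 - β * τ * 0 ^ 2 = c ^ 2 by ring, Real.sqrt_sq hc]
    have h5 : |(0 : ℝ) ^ 2 - mid β c τ| = c + β * τ / 2 := by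
      unfold mid
      rw [show (0 : ℝ) ^ 2 - (c + β * τ / 2) = -(c + β * τ / 2) by ring, abs_neg,
        abs_of_nonneg (by positivity)]
    rw [h4, h5]
    ring
  rw [h2, intervalIntegral.integral_congr_ae (Eventually.of_forall he),
    intervalIntegral.integral_sub (intervalIntegrable_log_mul_add hβ _) intervalIntegrable_const,
    integral_log_mul_add hβ]
  simp

end

/-! ### Positive definiteness of the logarithmic energy and comparison of energies -/

section

variable {β c : ℝ}

lemma log_abs_le_half_log_sq_add {r δ : ℝ} (hr : r ≠ 0) :
    Real.log |r| ≤ Real.log (r ^ 2 + δ ^ 2) / 2 := by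
  have h : Real.log |r| = Real.log (r ^ 2) / 2 := by rw [← sq_abs r, Real.log_pow]; simp
  rw [h]
  have : 0 < r ^ 2 := by positivity
  have h2 : Real.log (r ^ 2) ≤ Real.log (r ^ 2 + δ ^ 2) :=
    Real.log_le_log this (by linarith [sq_nonneg δ])
  linarith

/-- The logarithmic energy is positive definite: cross term bound. -/
theorem integral_log_abs_sub_prod_self_add_le (ν μ : Measure ℝ) [IsProbabilityMeasure ν]
    [IsProbabilityMeasure μ] (hν : Integrable (fun x => x) ν) (hμ : Integrable (fun x => x) μ)
    (hνν : Integrable (fun p : ℝ × ℝ => Real.log |p.1 - p.2|) (ν.prod ν))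
    (hμμ : Integrable (fun p : ℝ × ℝ => Real.log |p.1 - p.2|) (μ.prod μ))
    (hνμ : Integrable (fun p : ℝ × ℝ => Real.log |p.1 - p.2|) (ν.prod μ))
    (aνν : ∀ᵐ p : ℝ × ℝ ∂ν.prod ν, p.1 - p.2 ≠ 0) (aμμ : ∀ᵐ p : ℝ × ℝ ∂μ.prod μ, p.1 - p.2 ≠ 0)
    (aνμ : ∀ᵐ p : ℝ × ℝ ∂ν.prod μ, p.1 - p.2 ≠ 0) :
    ∫ p : ℝ × ℝ, Real.log |p.1 - p.2| ∂(ν.prod ν) + ∫ p : ℝ × ℝ, Real.log |p.1 - p.2| ∂(μ.prod μ)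
      ≤ 2 * ∫ p : ℝ × ℝ, Real.log |p.1 - p.2| ∂(ν.prod μ) := by
  have hlim : Tendsto (fun n : ℕ => ∫ p : ℝ × ℝ,
      Real.log ((p.1 - p.2) ^ 2 + (1 / ((n : ℝ) + 1)) ^ 2) / 2 ∂(ν.prod μ)) atTop
      (𝓝 (∫ p : ℝ × ℝ, Real.log |p.1 - p.2| ∂(ν.prod μ))) := by
    refine tendsto_integral_of_dominated_convergence
      -- For `δ ≤ 1` the regularised kernel lies between `log |r|` and its value at `δ = 1`.
      (fun p => |Real.log (|p.1 - p.2|)| + |Real.log ((p.1 - p.2) ^ 2 + 1 ^ 2) / 2|)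
      (fun n => Measurable.aestronglyMeasurable (by fun_prop))
      (hνμ.abs.add (integrable_log_sq_add_prod ν μ one_pos hν hμ).abs) (fun n => ?_) ?_
    · filter_upwards [aνμ] with p hp
      have h1 := log_abs_le_half_log_sq_add hp (δ := 1 / ((n : ℝ) + 1))
      have h2 : Real.log ((p.1 - p.2) ^ 2 + (1 / ((n : ℝ) + 1)) ^ 2) / 2
          ≤ Real.log ((p.1 - p.2) ^ 2 + 1 ^ 2) / 2 := by
        have : 1 / ((n : ℝ) + 1) ≤ 1 := by
          rw [div_le_one (by positivity)]
          linarith [n.cast_nonneg (α := ℝ)]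
        gcongr
      have h3 := neg_abs_le (Real.log |p.1 - p.2|)
      have h4 := le_abs_self (Real.log ((p.1 - p.2) ^ 2 + 1 ^ 2) / 2)
      have h5 := abs_nonneg (Real.log |p.1 - p.2|)
      have h6 := abs_nonneg (Real.log ((p.1 - p.2) ^ 2 + 1 ^ 2) / 2)
      exact abs_le.2 ⟨by linarith, by linarith⟩
    · filter_upwards [aνμ] with p hp
      have h : Real.log |p.1 - p.2| = Real.log ((p.1 - p.2) ^ 2 + 0 ^ 2) / 2 := by
        rw [← sq_abs (p.1 - p.2), zero_pow two_ne_zero, add_zero, Real.log_pow]; simp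
      rw [h]
      have hδ := tendsto_one_div_add_atTop_nhds_zero_nat (𝕜 := ℝ)
      exact (((hδ.pow 2).const_add _).log (by positivity)).div_const 2
  -- Only the mixed term needs a limit: off the diagonal the regularisation increases the kernel,
  -- which is the right direction for the two self-energies.
  refine ge_of_tendsto (hlim.const_mul 2) (Eventually.of_forall fun n => ?_)
  have hδ : 0 < 1 / ((n : ℝ) + 1) := by positivity
  refine le_trans (add_le_add ?_ ?_) (integral_log_sq_add_prod_self_add_le ν μ hδ hν hμ)
  · exact integral_mono_ae hνν (integrable_log_sq_add_prod ν ν hδ hν hν)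
      (aνν.mono fun p hp => log_abs_le_half_log_sq_add hp)
  · exact integral_mono_ae hμμ (integrable_log_sq_add_prod μ μ hδ hμ hμ)
      (aμμ.mono fun p hp => log_abs_le_half_log_sq_add hp)

lemma integrable_id_of_sq {ν : Measure ℝ} [IsProbabilityMeasure ν]
    (h : Integrable (fun x => x ^ 2) ν) : Integrable (fun x => x) ν := by
  refine (h.add (integrable_const (1 : ℝ))).mono' (by fun_prop) (Eventually.of_forall fun x => ?_)
  rw [Real.norm_eq_abs, Pi.add_apply]
  nlinarith [sq_abs x, sq_nonneg (|x| - 1)]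

lemma ae_sub_ne_zero_prod_eqMeasure (hβ : 0 < β) (hc : 0 ≤ c) (ν : Measure ℝ)
    [IsProbabilityMeasure ν] : ∀ᵐ p : ℝ × ℝ ∂ν.prod (eqMeasure β c), p.1 - p.2 ≠ 0 := by
  refine (Measure.ae_prod_iff_ae_ae (p := fun p : ℝ × ℝ => p.1 - p.2 ≠ 0)
    ((measurableSet_singleton (0 : ℝ)).compl.preimage (by fun_prop))).2 ?_
  exact Eventually.of_forall fun x => (ae_eqMeasure_ne hβ hc x).mono fun s hs => sub_ne_zero.2 hs

/-- The Euler–Lagrange constant of the equilibrium problem. -/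
noncomputable def robinConstant (β c : ℝ) : ℝ :=
  c - c * Real.log c - β / 2 * ∫ τ in 0..1, Real.log (rad β c τ / 2)

lemma integrable_potential_eqMeasure (hβ : 0 < β) (hc : 0 ≤ c) :
    Integrable (fun x => x ^ 2 - 2 * c * Real.log |x|) (eqMeasure β c) :=
  (integrable_sq_eqMeasure hβ hc).1.sub ((integral_log_abs_eqMeasure hβ hc).1.const_mul _)

lemma mul_integral_log_eqMeasure_prod_self (hβ : 0 < β) (hc : 0 ≤ c) :
    β * ∫ p : ℝ × ℝ, Real.log |p.1 - p.2| ∂((eqMeasure β c).prod (eqMeasure β c))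
      = ∫ x, (x ^ 2 - 2 * c * Real.log |x|) ∂eqMeasure β c - robinConstant β c := by
  have h2 := (integrable_sq_eqMeasure hβ hc).1
  rw [integral_prod _ (integrable_log_abs_sub_prod hβ hc _ (integrable_id_of_sq h2) h2),
    ← integral_const_mul]
  have : ∀ᵐ x ∂eqMeasure β c, (x ^ 2 - c) ^ 2 ≤ β * x ^ 2 := by
    refine ae_eqMeasure (measurableSet_le (by fun_prop) (by fun_prop)) ?_
    filter_upwards [ae_fst_mem] with p hp
    rw [neg_sq, Real.sq_sqrt (sqPoint_nonneg hβ hc hp), and_self_iff]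
    exact sq_sqPoint_sub_le hβ hc hp
  have hae : ∀ᵐ x ∂eqMeasure β c, β * ∫ s, Real.log |x - s| ∂eqMeasure β c
      = x ^ 2 - 2 * c * Real.log |x| - robinConstant β c := by
    filter_upwards [this, ae_eqMeasure_ne hβ hc 0] with x hx hx0
    exact (mul_potential_le hβ hc (fun h => absurd h.symm hx0)).2 hx
  rw [integral_congr_ae hae, integral_sub (integrable_potential_eqMeasure hβ hc)
    (integrable_const _), integral_const, probReal_univ, one_smul]

lemma integral_potential_add_robinConstant (hβ : 0 < β) (hc : 0 ≤ c) :
    (∫ x, (x ^ 2 - 2 * c * Real.log |x|) ∂eqMeasure β c + robinConstant β c) / 2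
      = 3 * β / 8 + β / 4 * Real.log (4 / β) + c * (3 / 2 + Real.log (4 / β))
        + 2 * c ^ 2 / β * Real.log (4 * c / β)
        - (2 * c ^ 2 / β + c + β / 8) * Real.log (1 + 4 * c / β) := by
  rw [integral_sub (integrable_sq_eqMeasure hβ hc).1
    ((integral_log_abs_eqMeasure hβ hc).1.const_mul _), integral_const_mul,
    (integrable_sq_eqMeasure hβ hc).2, (integral_log_abs_eqMeasure hβ hc).2, robinConstant,
    (log_rad_half_integral hβ hc).2]
  have h1 : 1 + 4 * c / β = (β + 4 * c) / β := by field_simp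
  rw [h1, Real.log_div (by norm_num) hβ.ne',
    Real.log_div (x := β + 4 * c) (by positivity) hβ.ne']
  -- The terms in `log c` are split off only for `c > 0`; for `c = 0` their coefficients vanish.
  rcases hc.eq_or_lt with rfl | hc0
  · simp
    field_simp
    ring
  · rw [Real.log_div (by positivity) hβ.ne', Real.log_mul (by norm_num) hc0.ne']
    field_simp
    ring

/-- Lower bound for the energy by the energy of the equilibrium measure. -/
theorem energy_lower_bound (hβ : 0 < β) (hc : 0 ≤ c) (ν : Measure ℝ) [IsProbabilityMeasure ν]
    (hq : Integrable (fun x => x ^ 2 - 2 * c * Real.log |x|) ν)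
    (h2 : Integrable (fun x => x ^ 2) ν) (h0 : ∀ᵐ x ∂ν, x = 0 → c = 0)
    (hνν : Integrable (fun p : ℝ × ℝ => Real.log |p.1 - p.2|) (ν.prod ν))
    (aνν : ∀ᵐ p : ℝ × ℝ ∂ν.prod ν, p.1 - p.2 ≠ 0) :
    (∫ x, (x ^ 2 - 2 * c * Real.log |x|) ∂eqMeasure β c + robinConstant β c) / 2
      ≤ β / 2 * (-∫ p : ℝ × ℝ, Real.log |p.1 - p.2| ∂(ν.prod ν))
        + ∫ x, (x ^ 2 - 2 * c * Real.log |x|) ∂ν := by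
  have m2 := (integrable_sq_eqMeasure hβ hc).1
  have m1 := integrable_id_of_sq m2
  have h1 := integrable_id_of_sq h2
  have hνμ := integrable_log_abs_sub_prod hβ hc ν h1 h2
  have hpos := integral_log_abs_sub_prod_self_add_le ν (eqMeasure β c) h1 m1 hνν
    (integrable_log_abs_sub_prod hβ hc _ m1 m2) hνμ aνν
    (ae_sub_ne_zero_prod_eqMeasure hβ hc _) (ae_sub_ne_zero_prod_eqMeasure hβ hc ν)
  have hself := mul_integral_log_eqMeasure_prod_self hβ hc
  have hcross : β * ∫ p : ℝ × ℝ, Real.log |p.1 - p.2| ∂(ν.prod (eqMeasure β c))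
      ≤ ∫ x, (x ^ 2 - 2 * c * Real.log |x|) ∂ν - robinConstant β c := by
    have e : ∫ x, (x ^ 2 - 2 * c * Real.log |x|) ∂ν - robinConstant β c
        = ∫ x, (x ^ 2 - 2 * c * Real.log |x| - robinConstant β c) ∂ν := by
      rw [integral_sub hq (integrable_const _), integral_const, probReal_univ, one_smul]
    rw [e, integral_prod _ hνμ, ← integral_const_mul]
    refine integral_mono_ae (hνμ.integral_prod_left.const_mul β) (hq.sub (integrable_const _)) ?_
    filter_upwards [h0] with x hx
    exact (mul_potential_le hβ hc hx).1
  have := mul_le_mul_of_nonneg_left hpos hβ.le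
  linarith

end

/-! ### Extended-real integrals -/

section

variable {α : Type*} [MeasurableSpace α] {μ : Measure α} {f : α → EReal} {g : α → ℝ}

lemma extIntegral_eq_coe_integral (hg : Integrable g μ) (h : ∀ᵐ x ∂μ, f x = (g x : EReal)) :
    extIntegral μ f = ((∫ x, g x ∂μ : ℝ) : EReal) := by
  have h1 : ∫⁻ x, (f x).toENNReal ∂μ = ∫⁻ x, ENNReal.ofReal (g x) ∂μ :=
    lintegral_congr_ae (h.mono fun x hx => by simp only [hx, EReal.real_coe_toENNReal])
  have h2 : ∫⁻ x, (-f x).toENNReal ∂μ = ∫⁻ x, ENNReal.ofReal (-g x) ∂μ :=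
    lintegral_congr_ae (h.mono fun x hx => by
      simp only [hx, ← EReal.coe_neg, EReal.real_coe_toENNReal])
  have f1 : ∫⁻ x, ENNReal.ofReal (g x) ∂μ ≠ ⊤ := hg.lintegral_lt_top.ne
  have f2 : ∫⁻ x, ENNReal.ofReal (-g x) ∂μ ≠ ⊤ := hg.neg.lintegral_lt_top.ne
  rw [extIntegral, h1, h2, integral_eq_lintegral_pos_part_sub_lintegral_neg_part hg, EReal.coe_sub,
    EReal.coe_ennreal_toReal f1, EReal.coe_ennreal_toReal f2]

lemma extIntegral_eq_top_or (hf : Measurable f) (hg : Measurable g)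
    (hfg : ∀ x, f x = ⊤ ∨ f x = (g x : EReal)) (hneg : ∫⁻ x, (-f x).toENNReal ∂μ ≠ ⊤) :
    extIntegral μ f = ⊤ ∨ ((∀ᵐ x ∂μ, f x ≠ ⊤) ∧ Integrable g μ ∧
      extIntegral μ f = ((∫ x, g x ∂μ : ℝ) : EReal)) := by
  by_cases hpos : ∫⁻ x, (f x).toENNReal ∂μ = ⊤
  · left
    rw [extIntegral, hpos]
    lift ∫⁻ x, (-f x).toENNReal ∂μ to NNReal using hneg with a
    exact EReal.top_sub_coe a
  · right
    have hne : ∀ᵐ x ∂μ, f x ≠ ⊤ := by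
      filter_upwards [ae_lt_top hf.ereal_toENNReal hpos] with x hx
      exact EReal.toENNReal_ne_top_iff.1 hx.ne
    have heq : ∀ᵐ x ∂μ, f x = (g x : EReal) := hne.mono fun x hx => (hfg x).resolve_left hx
    have hgi : Integrable g μ := by
      refine ⟨hg.aestronglyMeasurable, ?_⟩
      refine lt_of_le_of_lt (lintegral_mono_ae (g := fun x => (f x).toENNReal + (-f x).toENNReal) ?_) ?_
      · filter_upwards [heq] with x hx
        rw [hx, ← EReal.coe_neg, EReal.real_coe_toENNReal, EReal.real_coe_toENNReal,
          Real.enorm_eq_ofReal_abs]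
        rcases le_total 0 (g x) with h | h
        · rw [abs_of_nonneg h]; exact le_self_add
        · rw [abs_of_nonpos h]; exact le_add_self
      · rw [lintegral_add_left hf.ereal_toENNReal]
        exact ENNReal.add_lt_top.2 ⟨lt_top_iff_ne_top.2 hpos, lt_top_iff_ne_top.2 hneg⟩
    exact ⟨hne, hgi, extIntegral_eq_coe_integral hgi heq⟩

end

/-! ### Reduction of the extended-real energy to real integrals -/

lemma logInv_of_ne_zero {r : ℝ} (hr : r ≠ 0) : logInv r = ((-Real.log |r| : ℝ) : EReal) := by
  rw [logInv, if_neg hr, one_div, Real.log_inv]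

lemma measurable_logInv : Measurable logInv := by
  unfold logInv
  refine Measurable.ite (measurableSet_singleton 0) measurable_const ?_
  exact measurable_coe_real_ereal.comp (by fun_prop)

lemma measurable_potentialQ (c : ℝ) : Measurable (potentialQ c) := by
  have h1 : Measurable fun t : ℝ => ((t ^ 2 : ℝ) : EReal) :=
    measurable_coe_real_ereal.comp (by fun_prop)
  exact h1.add (measurable_logInv.const_mul _)

lemma potentialQ_eq {c t : ℝ} (h : t = 0 → c = 0) :
    potentialQ c t = ((t ^ 2 - 2 * c * Real.log |t| : ℝ) : EReal) := by
  unfold potentialQ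
  by_cases ht : t = 0
  · rw [h ht, ht]; simp
  · rw [logInv_of_ne_zero ht, ← EReal.coe_mul, ← EReal.coe_add]
    congr 1
    ring

lemma potentialQ_zero {c : ℝ} (hc : 0 < c) : potentialQ c 0 = ⊤ := by
  unfold potentialQ logInv
  rw [if_pos rfl, EReal.coe_mul_top_of_pos (by positivity)]
  simp

/-- From `log |t| ≤ |t|` and the square `(|t| - 2 c)²`. It bounds the potential below by `-2 c²`,
and it gives a finite second moment whenever the potential is integrable. -/
lemma half_sq_sub_le {c : ℝ} (hc : 0 ≤ c) (t : ℝ) :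
    t ^ 2 / 2 - 2 * c ^ 2 ≤ t ^ 2 - 2 * c * Real.log |t| := by
  have h1 := mul_le_mul_of_nonneg_left (Real.log_le_self (abs_nonneg t)) hc
  nlinarith [sq_nonneg (|t| - 2 * c), sq_abs t]

theorem proposition4p7 (β c : ℝ) (hβ : 0 < β) (hc : 0 ≤ c) :
    equilibriumEnergy β c =
      ((3 * β / 8 + β / 4 * Real.log (4 / β) + c * (3 / 2 + Real.log (4 / β))
        + 2 * c ^ 2 / β * Real.log (4 * c / β)
        - (2 * c ^ 2 / β + c + β / 8) * Real.log (1 + 4 * c / β) : ℝ) : EReal) := by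
  rw [← integral_potential_add_robinConstant hβ hc]
  apply le_antisymm
  · refine (iInf_le _ ⟨eqMeasure β c, inferInstance⟩).trans_eq ?_
    have h2 := (integrable_sq_eqMeasure hβ hc).1
    have hQ : extIntegral (eqMeasure β c) (potentialQ c) = _ :=
      extIntegral_eq_coe_integral (integrable_potential_eqMeasure hβ hc) (by
        filter_upwards [ae_eqMeasure_ne hβ hc 0] with x hx
        exact potentialQ_eq fun h => absurd h.symm hx)
    have hI : extIntegral ((eqMeasure β c).prod (eqMeasure β c)) (fun p => logInv (p.1 - p.2)) = _ :=
      extIntegral_eq_coe_integral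
        (integrable_log_abs_sub_prod hβ hc _ (integrable_id_of_sq h2) h2).neg (by
        filter_upwards [ae_sub_ne_zero_prod_eqMeasure hβ hc (eqMeasure β c)] with p hp
        exact logInv_of_ne_zero hp)
    have hQtop : extIntegral (eqMeasure β c) (potentialQ c) ≠ ⊤ := hQ ▸ EReal.coe_ne_top _
    unfold logEnergy
    rw [ProbabilityMeasure.coe_mk, if_neg hQtop, hQ, hI, ← EReal.coe_mul, ← EReal.coe_add]
    congr 1
    have hself := mul_integral_log_eqMeasure_prod_self hβ hc
    simp only [Pi.neg_apply]
    rw [integral_neg]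
    linarith
  · refine le_iInf fun ν => ?_
    unfold logEnergy
    split_ifs with hQtop
    · exact le_top
    have hQ := (extIntegral_eq_top_or (μ := (ν : Measure ℝ)) (measurable_potentialQ c)
      (g := fun x => x ^ 2 - 2 * c * Real.log |x|) (by fun_prop) (fun x => ?_) ?_).resolve_left hQtop
    rotate_left
    · by_cases hx : x = 0 → c = 0
      · exact Or.inr (potentialQ_eq hx)
      · push Not at hx
        rw [hx.1]
        exact Or.inl (potentialQ_zero (hc.lt_of_ne' hx.2))
    · refine ne_top_of_le_ne_top (b := ∫⁻ _, ENNReal.ofReal (2 * c ^ 2) ∂(ν : Measure ℝ)) ?_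
        (lintegral_mono fun x => ?_)
      · rw [lintegral_const, measure_univ, mul_one]
        exact ENNReal.ofReal_ne_top
      · rw [← EReal.real_coe_toENNReal]
        refine EReal.toENNReal_le_toENNReal ?_
        by_cases hx : x = 0 → c = 0
        · rw [potentialQ_eq hx, ← EReal.coe_neg, EReal.coe_le_coe_iff]
          linarith [half_sq_sub_le hc x, sq_nonneg x]
        · push Not at hx
          rw [hx.1, potentialQ_zero (hc.lt_of_ne' hx.2)]
          simp
    obtain ⟨hne, hq, hQv⟩ := hQ
    -- For `c > 0`, an atom at `0` would make the integral of the potential infinite.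
    have h0 : ∀ᵐ x ∂(ν : Measure ℝ), x = 0 → c = 0 := by
      filter_upwards [hne] with x hx hx0
      by_contra hcne
      exact hx (hx0 ▸ potentialQ_zero (hc.lt_of_ne' hcne))
    have h2 : Integrable (fun x => x ^ 2) (ν : Measure ℝ) := by
      refine ((hq.add (integrable_const (2 * c ^ 2))).const_mul 2).mono' (by fun_prop)
        (Eventually.of_forall fun x => ?_)
      rw [Real.norm_of_nonneg (sq_nonneg x)]
      simp only [Pi.add_apply]
      linarith [half_sq_sub_le hc x]
    have h1 := integrable_id_of_sq h2
    have hI := extIntegral_eq_top_or (μ := (ν : Measure ℝ).prod (ν : Measure ℝ))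
      (f := fun p => logInv (p.1 - p.2)) (g := fun p => -Real.log |p.1 - p.2|)
      (measurable_logInv.comp (by fun_prop)) (by fun_prop) (fun p => ?_) ?_
    rotate_left
    · by_cases hp : p.1 - p.2 = 0
      · exact Or.inl (by rw [hp, logInv, if_pos rfl])
      · exact Or.inr (logInv_of_ne_zero hp)
    -- The negative part of the kernel is at most `|s - t|`, integrable by the first moment.
    · refine ne_top_of_le_ne_top (integrable_sub_prod (ν : Measure ℝ) (ν : Measure ℝ)
        h1 h1).abs.lintegral_lt_top.ne (lintegral_mono fun p => ?_)
      rw [← EReal.real_coe_toENNReal]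
      refine EReal.toENNReal_le_toENNReal ?_
      by_cases hp : p.1 - p.2 = 0
      · rw [hp, logInv, if_pos rfl]
        simp
      · rw [logInv_of_ne_zero hp, ← EReal.coe_neg, EReal.coe_le_coe_iff, neg_neg]
        exact Real.log_le_self (abs_nonneg _)
    rw [hQv]
    rcases hI with hI | ⟨hIne, hIi, hIv⟩
    · rw [hI, EReal.coe_mul_top_of_pos (by positivity), EReal.top_add_coe]
      exact le_top
    -- Finite logarithmic energy forbids mass on the diagonal, so the default `Real.log 0 = 0` plays
    -- no role.
    · have aνν : ∀ᵐ p : ℝ × ℝ ∂(ν : Measure ℝ).prod (ν : Measure ℝ), p.1 - p.2 ≠ 0 := by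
        filter_upwards [hIne] with p hp h
        exact hp (by rw [h, logInv, if_pos rfl])
      have hνν : Integrable (fun p : ℝ × ℝ => Real.log |p.1 - p.2|)
          ((ν : Measure ℝ).prod (ν : Measure ℝ)) := by
        simpa only [Pi.neg_def, neg_neg] using hIi.neg
      rw [hIv, ← EReal.coe_mul, ← EReal.coe_add, EReal.coe_le_coe_iff, integral_neg]
      exact energy_lower_bound hβ hc ν hq h2 h0 hνν aνν
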